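/- Let $\mu,\nu$ be probability measures on $\mathbb R$ with finite first moments and $\mu\le_{cx}\nu$, that is, $\int f\,d\mu\le\int f\,d\nu$ for all convex $f:\mathbb R\to\mathbb R$. For a finite measure $\eta$ with finite first moment put $P_\eta(k)=\int (k-x)^+\,\eta(dx)$, let $D=P_\nu-P_\mu$, and assume that $\{k\in\mathbb R: D(k)>0\}$ is an interval (possibly empty). For $f:\mathbb R\to[0,\infty)$ let $f^c$ be the largest convex function below $f$. Let $G$ be the left-continuous quantile function of $\mu$. For $u\in(0,1)$ define $$\mu_u=\mu|_{(-\infty,G(u))}+\bigl(u-\mu((-\infty,G(u)))\bigr)\delta_{G(u)},\qquad \mathcal E_u=P_\nu-P_{\mu_u},$$ $$S(u)=\inf\{z\ge G(u):\mathcal E_u^c(z)=\mathcal E_u(z)\},\qquad \phi(u)=\inf\partial\mathcal E_u^c(G(u)),$$ $$R(u)=\inf\{k\le G(u): D(k)=\mathcal E_u^c(G(u))+\phi(u)(k-G(u))\}\in[-\infty,\infty),$$ where $\partial$ denotes the subdifferential. Put $p(u)=\frac{S(u)-G(u)}{S(u)-R(u)}$, with the conventions $\frac00=0$ and $\frac c\infty=0$,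 and let $S^{-1}(y)=\inf\{u\in(0,1):S(u)>y\}$ (with $\inf\emptyset=1$) be the right-continuous inverse of $S$. On $(0,1)^2$ with Lebesgue measure define $Y(u,v)=G(u)$ if $R(u)=S(u)$, and otherwise $Y(u,v)=R(u)$ if $v\le p(u)$ and $Y(u,v)=S(u)$ if $v>p(u)$. Let $\chi$ be the law of $Y$. Let $y\in\mathbb R$ satisfy $\mu(\{y\})=\nu(\{y\})=0$. Then $P_\nu$ is differentiable at $y$, the function $v\mapsto p(v)\,\mathbf 1_{\{R(v)\le y\}}$ is integrable on $(S^{-1}(y),1)$, and $$\int_{S^{-1}(y)}^1\frac{S(v)-G(v)}{S(v)-R(v)}\,\mathbf 1_{\{R(v)\le y\}}\,dv=P_\nu'(y)-S^{-1}(y).$$ Moreover $Y$ is measurable with respect to the completed Lebesgue $\sigma$-algebra, and $\chi((-\infty,y])=\nu((-\infty,y])$. -/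

import Mathlib

open MeasureTheory Set

noncomputable section

namespace LeftCurtain

/-- The convex order: `∫ f dη ≤ ∫ f dχ` for every convex `f : ℝ → ℝ`. For measures with finite first
moment both sides lie in `(-∞, ∞]`, since a convex function has an affine minorant; the inequality
is void when the right side is `∞`, and says that the left side is finite when the right side is. -/
def ConvexOrder (η χ : Measure ℝ) : Prop :=
  ∀ f : ℝ → ℝ, ConvexOn ℝ univ f → Integrable f χ →
    Integrable f η ∧ ∫ x, f x ∂η ≤ ∫ x, f x ∂χ

/-- The modified potential `P_η(k) = ∫ (k - x)⁺ η(dx)`. -/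
def P (η : Measure ℝ) (k : ℝ) : ℝ := ∫ x, max (k - x) 0 ∂η

/-- `D = P_ν - P_μ`. -/
def D (μ ν : Measure ℝ) (k : ℝ) : ℝ := P ν k - P μ k

/-- The left-continuous quantile function `G(u) = inf {x : u ≤ F_μ(x)}`, for `u ∈ (0,1)`. -/
def G (μ : Measure ℝ) (u : ℝ) : ℝ := sInf {x : ℝ | u ≤ μ.real (Iic x)}

/-- The measure `μ_u`, the restriction of `μ` to its lowest mass `u`:
`μ_u = μ|_{(-∞, G(u))} + (u - μ((-∞, G(u)))) δ_{G(u)}`. -/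
def lower (μ : Measure ℝ) (u : ℝ) : Measure ℝ :=
  μ.restrict (Iio (G μ u)) +
    ENNReal.ofReal (u - μ.real (Iio (G μ u))) • Measure.dirac (G μ u)

/-- `E_u = P_ν - P_{μ_u}`. -/
def E (μ ν : Measure ℝ) (u k : ℝ) : ℝ := P ν k - P (lower μ u) k

/-- The convex hull `f^c`, the largest convex function below `f` (for `f` with at least one
real-valued convex minorant; below it is applied to non-negative functions). -/
def hull (f : ℝ → ℝ) (k : ℝ) : ℝ :=
  sSup {z : ℝ | ∃ g : ℝ → ℝ, ConvexOn ℝ univ g ∧ (∀ x, g x ≤ f x) ∧ g k = z}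

/-- The subdifferential of `f` at `x`. -/
def subdiff (f : ℝ → ℝ) (x : ℝ) : Set ℝ := {θ : ℝ | ∀ y, f x + θ * (y - x) ≤ f y}

/-- The upper function `S(u) = inf {z ≥ G(u) : E_u^c(z) = E_u(z)}`, for `u ∈ (0,1)`. -/
def S (μ ν : Measure ℝ) (u : ℝ) : ℝ :=
  sInf {z : ℝ | G μ u ≤ z ∧ hull (E μ ν u) z = E μ ν u z}

/-- The slope `φ(u) = inf ∂E_u^c(G(u))`. -/
def slope (μ ν : Measure ℝ) (u : ℝ) : ℝ := sInf (subdiff (hull (E μ ν u)) (G μ u))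

/-- The lower function
`R(u) = inf {k ≤ G(u) : D(k) = E_u^c(G(u)) + φ(u) (k - G(u))}`, for `u ∈ (0,1)`.
The infimum is taken in `[-∞, ∞]`, since the set may be unbounded below: for instance it is
`(-∞, G(u)]` when `D` vanishes on `(-∞, G(u)]`. -/
def R (μ ν : Measure ℝ) (u : ℝ) : EReal :=
  sInf {r : EReal | ∃ k : ℝ, k ≤ G μ u ∧
    D μ ν k = hull (E μ ν u) (G μ u) + slope μ ν u * (k - G μ u) ∧ r = (k : EReal)}

/-- The weight `(S(u) - G(u)) / (S(u) - R(u))`, with `0 / 0 = 0` and `c / ∞ = 0`. -/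
def weight (μ ν : Measure ℝ) (u : ℝ) : ℝ :=
  (((S μ ν u - G μ u : ℝ) : EReal) / ((S μ ν u : EReal) - R μ ν u)).toReal

/-- The right-continuous inverse `S⁻¹(y) = inf {u ∈ (0,1) : S(u) > y}`, with `inf ∅ = 1`. -/
def invS (μ ν : Measure ℝ) (y : ℝ) : ℝ :=
  sInf (insert 1 {u : ℝ | u ∈ Ioo (0 : ℝ) 1 ∧ y < S μ ν u})

open Classical in
/-- The random variable `Y` on `(0,1) × (0,1)`: `Y(u,v) = G(u)` if `R(u) = S(u)`; otherwise
`Y(u,v) = R(u)` if `v ≤ (S(u) - G(u)) / (S(u) - R(u))`, and `Y(u,v) = S(u)` if not. (If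
`R(u) = -∞` the threshold is `0 < v`, so that `Y(u,v) = S(u)`.) -/
def Y (μ ν : Measure ℝ) (ω : ℝ × ℝ) : ℝ :=
  if R μ ν ω.1 = (S μ ν ω.1 : EReal) then G μ ω.1
  else if ω.2 ≤ weight μ ν ω.1 then (R μ ν ω.1).toReal else S μ ν ω.1

/-- Lebesgue measure on `(0,1) × (0,1)`, the law of two independent uniform variables. -/
def unif : Measure (ℝ × ℝ) :=
  (volume : Measure (ℝ × ℝ)).restrict (Ioo (0 : ℝ) 1 ×ˢ Ioo (0 : ℝ) 1)

/-- The law `χ` of `Y`. -/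
def law (μ ν : Measure ℝ) : Measure ℝ := unif.map (Y μ ν)

end LeftCurtain

end

/-! The proof shows that `Y` has law `ν` and then reads the formula off by conditioning on the level
`u`. Since a potential has the distribution function as its right derivative, it suffices that the
law of `Y` has potential `P ν`.

Fix `y` and let the level `u` vary. Formally `P (lower μ u) y` is the integral of `(y - G w)⁺` over
`w < u`, so `E μ ν u y` has `u`-derivative `-(y - G u)⁺` wherever `G` is continuous. The hull of `E
μ ν u` touches `E μ ν u` at `R u` and at every point from `S u` on, and it is affine on `[R u, S
u]`. Hence, to first order, the hull at `y` moves with the values of `E` at the points of contact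
that carry it. This envelope argument (`eq_neg_levelPotential`) gives `-levelPotential μ ν y u` as
derivative, where `levelPotential` is the potential of the conditional law of `Y` given `u`: mass
`p` at `R u`, mass `1 - p` at `S u`.

The hull at `y` is locally Lipschitz in `u`, tends to `P ν y` as `u → 0` and to `0` as `u → 1`.
Integrating the derivative over `(0, 1)` yields `lintegral_levelPotential`, hence `P_law` and
`law_Iic`.

The picture of the hull can fail only where the hull vanishes at `G u` while `D` is positive there.
Because `{D > 0}` is an interval, this happens at one level at most (`exceptional_subsingleton`).

Finally, given `u`, the event `Y ≤ y` has probability `1` if `S u ≤ y`, and otherwise `p u` if `R u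
≤ y` and `0` if not. As `S` is monotone, the levels split at `invS μ ν y`, and integrating gives the
identity. -/

namespace LeftCurtain
open Filter Topology

/-! ### Potentials of finite measures -/

section Potential

variable {η : Measure ℝ} [IsFiniteMeasure η]

lemma integrable_max (hη : Integrable (fun x : ℝ => x) η) (k : ℝ) :
    Integrable (fun x => max (k - x) 0) η :=
  ((integrable_const k).sub hη).pos_part

lemma P_nonneg (η : Measure ℝ) (k : ℝ) : 0 ≤ P η k :=
  integral_nonneg fun _ => le_max_right _ _

lemma cdf_mono (η : Measure ℝ) [IsFiniteMeasure η] {a b : ℝ} (h : a ≤ b) :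
    η.real (Iic a) ≤ η.real (Iic b) :=
  measureReal_mono (Iic_subset_Iic.2 h)

lemma integral_indicator_mul {η : Measure ℝ} (s : Set ℝ) (hs : MeasurableSet s) (c : ℝ) :
    ∫ x, s.indicator (fun _ => c) x ∂η = η.real s * c := by
  rw [integral_indicator hs, setIntegral_const, smul_eq_mul]

lemma tendsto_cdf_nhdsGT (k : ℝ) :
    Tendsto (fun l => η.real (Iic l)) (𝓝[>] k) (𝓝 (η.real (Iic k))) := by
  have h := tendsto_measure_biInter_gt (μ := η) (s := fun l : ℝ => Iic l) (a := k)
    (fun r _ => measurableSet_Iic.nullMeasurableSet)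
    (fun i j _ hij => Iic_subset_Iic.2 hij) ⟨k + 1, by simp, measure_ne_top _ _⟩
  have he : (⋂ r > k, Iic r) = Iic k := by
    ext x
    simp only [gt_iff_lt, mem_iInter, mem_Iic]
    exact ⟨fun h => le_of_forall_gt_imp_ge_of_dense h, fun h r hr => h.trans hr.le⟩
  rw [he] at h
  exact (ENNReal.tendsto_toReal (measure_ne_top _ _)).comp h

lemma tendsto_cdf_nhdsLT (k : ℝ) :
    Tendsto (fun l => η.real (Iic l)) (𝓝[<] k) (𝓝 (η.real (Iio k))) := by
  have hm : Monotone fun l => η.real (Iic l) := fun a b h => cdf_mono η h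
  obtain ⟨s, hs, hlt, hlim⟩ := exists_seq_strictMono_tendsto k
  have h1 := (hm.tendsto_nhdsLT k).comp (tendsto_nhdsWithin_iff.2 ⟨hlim, .of_forall hlt⟩)
  have h2 := tendsto_measure_iUnion_atTop (μ := η) (s := fun n => Iic (s n))
    (fun i j hij => Iic_subset_Iic.2 (hs.monotone hij))
  rw [iUnion_Iic_eq_Iio_of_lt_of_tendsto hlt hlim] at h2
  have h3 := (ENNReal.tendsto_toReal (measure_ne_top η (Iio k))).comp h2
  have h4 := tendsto_nhds_unique h1 h3
  have h5 := hm.tendsto_nhdsLT k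
  rwa [h4] at h5

/-- The distribution function is a subgradient of the potential. -/
lemma cdf_mul_le_P_sub (hη : ∀ k : ℝ, Integrable (fun x => max (k - x) 0) η) (k l : ℝ) :
    η.real (Iic k) * (l - k) ≤ P η l - P η k := by
  unfold P
  rw [← integral_sub (hη l) (hη k), ← integral_indicator_mul _ measurableSet_Iic]
  refine integral_mono ((integrable_const _).indicator measurableSet_Iic)
    ((hη l).sub (hη k)) fun x => ?_
  by_cases hx : x ∈ Iic k
  · simp only [indicator_of_mem hx]
    have : x ≤ k := hx
    rw [max_eq_left (by linarith : 0 ≤ k - x)]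
    linarith [le_max_left (l - x) 0]
  · simp only [indicator_of_notMem hx]
    have : k < x := not_le.1 hx
    rw [max_eq_right (by linarith : k - x ≤ 0)]
    linarith [le_max_right (l - x) 0]

/-- The left limit of the distribution function is a subgradient of the potential. -/
lemma measureReal_Iio_mul_le_P_sub (hη : ∀ k : ℝ, Integrable (fun x => max (k - x) 0) η)
    (k l : ℝ) : η.real (Iio k) * (l - k) ≤ P η l - P η k := by
  unfold P
  rw [← integral_sub (hη l) (hη k), ← integral_indicator_mul _ measurableSet_Iio]
  refine integral_mono ((integrable_const _).indicator measurableSet_Iio)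
    ((hη l).sub (hη k)) fun x => ?_
  by_cases hx : x ∈ Iio k
  · simp only [indicator_of_mem hx]
    have : x < k := hx
    rw [max_eq_left (by linarith : 0 ≤ k - x)]
    linarith [le_max_left (l - x) 0]
  · simp only [indicator_of_notMem hx]
    have : k ≤ x := not_lt.1 hx
    rw [max_eq_right (by linarith : k - x ≤ 0)]
    linarith [le_max_right (l - x) 0]

lemma P_sub_le (hη : ∀ k : ℝ, Integrable (fun x => max (k - x) 0) η) (k l : ℝ) :
    P η l - P η k ≤ η.real (Iic l) * (l - k) := by
  have := cdf_mul_le_P_sub hη l k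
  linarith

lemma P_mono (hη : ∀ k : ℝ, Integrable (fun x => max (k - x) 0) η) : Monotone (P η) := by
  intro k l h
  have := cdf_mul_le_P_sub hη k l
  have := mul_nonneg (measureReal_nonneg (μ := η) (s := Iic k)) (sub_nonneg.2 h)
  linarith

lemma convexOn_P (hη : ∀ k : ℝ, Integrable (fun x => max (k - x) 0) η) :
    ConvexOn ℝ univ (P η) := by
  refine ⟨convex_univ, fun x _ z _ a b ha hb hab => ?_⟩
  have h1 := cdf_mul_le_P_sub hη (a • x + b • z) x
  have h2 := cdf_mul_le_P_sub hη (a • x + b • z) z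
  simp only [smul_eq_mul] at *
  have h3 := mul_le_mul_of_nonneg_left h1 ha
  have h4 := mul_le_mul_of_nonneg_left h2 hb
  have hb' : b = 1 - a := by linarith
  subst hb'
  nlinarith

lemma continuous_P (hη : ∀ k : ℝ, Integrable (fun x => max (k - x) 0) η) :
    Continuous (P η) := by
  have := (convexOn_P hη).continuousOn_interior
  simpa [continuousOn_univ] using this

/-- The right derivative of the potential is the distribution function. -/
lemma hasDerivWithinAt_P (hη : ∀ k : ℝ, Integrable (fun x => max (k - x) 0) η) (k : ℝ) :
    HasDerivWithinAt (P η) (η.real (Iic k)) (Ioi k) k := by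
  rw [hasDerivWithinAt_iff_tendsto_slope' self_notMem_Ioi]
  have hF := tendsto_cdf_nhdsGT (η := η) k
  refine tendsto_of_tendsto_of_tendsto_of_le_of_le' tendsto_const_nhds hF ?_ ?_
  · filter_upwards [self_mem_nhdsWithin] with l hl
    have hl : k < l := hl
    rw [slope_def_field, le_div_iff₀ (by linarith)]
    exact cdf_mul_le_P_sub hη k l
  · filter_upwards [self_mem_nhdsWithin] with l hl
    have hl : k < l := hl
    rw [slope_def_field, div_le_iff₀ (by linarith)]
    exact P_sub_le hη k l

/-- At a point that is not an atom the potential is differentiable. -/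
lemma hasDerivAt_P (hη : ∀ k : ℝ, Integrable (fun x => max (k - x) 0) η) {k : ℝ}
    (hk : η {k} = 0) : HasDerivAt (P η) (η.real (Iic k)) k := by
  have hF := tendsto_cdf_nhdsLT (η := η) k
  have he : η.real (Iio k) = η.real (Iic k) := by
    rw [Measure.real, Measure.real, ← Iio_union_right,
      measure_union (by simp) (measurableSet_singleton k), hk, add_zero]
  rw [he] at hF
  have hl : HasDerivWithinAt (P η) (η.real (Iic k)) (Iio k) k := by
    rw [hasDerivWithinAt_iff_tendsto_slope' self_notMem_Iio]
    refine tendsto_of_tendsto_of_tendsto_of_le_of_le' hF tendsto_const_nhds ?_ ?_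
    · filter_upwards [self_mem_nhdsWithin] with l hl
      have hl : l < k := hl
      rw [slope_comm, slope_def_field, le_div_iff₀ (by linarith)]
      exact cdf_mul_le_P_sub hη l k
    · filter_upwards [self_mem_nhdsWithin] with l hl
      have hl : l < k := hl
      rw [slope_comm, slope_def_field, div_le_iff₀ (by linarith)]
      exact P_sub_le hη l k
  have := (hl.Iic_of_Iio).union (hasDerivWithinAt_P hη k).Ici_of_Ioi
  rwa [Iic_union_Ici, hasDerivWithinAt_univ] at this

lemma tendsto_P_atBot (hη : Integrable (fun x : ℝ => x) η) : Tendsto (P η) atBot (𝓝 0) := by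
  have h : Tendsto (fun k => ∫ x, max (k - x) 0 ∂η) atBot (𝓝 (∫ _, (0 : ℝ) ∂η)) := by
    refine tendsto_integral_filter_of_dominated_convergence (fun x => |x|)
      (Eventually.of_forall fun k => (integrable_max hη k).aestronglyMeasurable) ?_ hη.abs
      (Eventually.of_forall fun x => ?_)
    · filter_upwards [eventually_le_atBot (0 : ℝ)] with k hk
      refine Eventually.of_forall fun x => ?_
      rw [Real.norm_eq_abs, abs_of_nonneg (le_max_right _ _)]
      exact max_le (by linarith [neg_abs_le x]) (abs_nonneg x)
    · refine tendsto_const_nhds.congr' ?_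
      filter_upwards [eventually_le_atBot x] with k hk
      rw [max_eq_right (by linarith)]
  rw [integral_zero] at h
  exact h

end Potential

/-! ### Behaviour of the potential at `+∞` -/

section Probability

variable {η : Measure ℝ} [IsProbabilityMeasure η]

/-- Put-call parity, that is `(k - x)⁺ - (k - x) = (x - k)⁺` integrated. It controls the potential
at `+∞`. -/
lemma P_sub_eq (hη : Integrable (fun x : ℝ => x) η) (k : ℝ) :
    P η k - (k - ∫ x, x ∂η) = ∫ x, max (x - k) 0 ∂η := by
  have h : k - ∫ x, x ∂η = ∫ x, (k - x) ∂η := by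
    rw [integral_sub (integrable_const k) hη]; simp
  have h2 : Integrable (fun x => k - x) η := (integrable_const k).sub hη
  rw [h, P, ← integral_sub (integrable_max hη k) h2]
  refine integral_congr_ae (Eventually.of_forall fun x => ?_)
  simp only
  rcases le_total k x with hx | hx
  · rw [max_eq_right (by linarith), max_eq_left (by linarith)]; ring
  · rw [max_eq_left (by linarith), max_eq_right (by linarith)]; ring

lemma sub_mean_le_P (hη : Integrable (fun x : ℝ => x) η) (k : ℝ) : k - ∫ x, x ∂η ≤ P η k := by
  have : 0 ≤ ∫ x, max (x - k) 0 ∂η := integral_nonneg fun _ => le_max_right _ _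
  rw [← P_sub_eq hη] at this
  linarith

lemma tendsto_P_sub_atTop (hη : Integrable (fun x : ℝ => x) η) :
    Tendsto (fun k => P η k - (k - ∫ x, x ∂η)) atTop (𝓝 0) := by
  simp_rw [P_sub_eq hη]
  have h : Tendsto (fun k => ∫ x, max (x - k) 0 ∂η) atTop (𝓝 (∫ _, (0 : ℝ) ∂η)) := by
    refine tendsto_integral_filter_of_dominated_convergence (fun x => |x|)
      (Eventually.of_forall fun k => (hη.sub (integrable_const k)).pos_part.aestronglyMeasurable)
      ?_ hη.abs (Eventually.of_forall fun x => ?_)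
    · filter_upwards [eventually_ge_atTop (0 : ℝ)] with k hk
      refine Eventually.of_forall fun x => ?_
      rw [Real.norm_eq_abs, abs_of_nonneg (le_max_right _ _)]
      exact max_le (by linarith [le_abs_self x]) (abs_nonneg x)
    · refine tendsto_const_nhds.congr' ?_
      filter_upwards [eventually_ge_atTop x] with k hk
      rw [max_eq_right (by linarith)]
  simpa using h

end Probability

/-! ### Consequences of the convex order -/

section Order

variable {μ ν : Measure ℝ}

lemma ConvexOrder.mean_eq (hν : Integrable (fun x : ℝ => x) ν) (h : ConvexOrder μ ν) :
    ∫ x, x ∂μ = ∫ x, x ∂ν := by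
  have h1 := (h (fun x => x) (convexOn_id convex_univ) hν).2
  have h2 := (h (fun x => -x) (concaveOn_id convex_univ).neg hν.neg).2
  rw [integral_neg, integral_neg] at h2
  linarith

lemma ConvexOrder.D_nonneg [IsFiniteMeasure ν] (hν : Integrable (fun x : ℝ => x) ν) (h : ConvexOrder μ ν) (k : ℝ) :
    0 ≤ D μ ν k := by
  have hc : ConvexOn ℝ univ (fun x : ℝ => max (k - x) 0) :=
    ((convexOn_const k convex_univ).sub (concaveOn_id convex_univ)).sup
      (convexOn_const 0 convex_univ)
  have := (h _ hc (integrable_max hν k)).2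
  simpa [D, P] using this

variable [IsProbabilityMeasure μ] [IsProbabilityMeasure ν]

lemma tendsto_D_atBot (hμ : Integrable (fun x : ℝ => x) μ) (hν : Integrable (fun x : ℝ => x) ν) :
    Tendsto (D μ ν) atBot (𝓝 0) := by
  have := (tendsto_P_atBot hν).sub (tendsto_P_atBot hμ)
  rw [sub_zero] at this
  exact this

lemma ConvexOrder.tendsto_D_atTop (hμ : Integrable (fun x : ℝ => x) μ)
    (hν : Integrable (fun x : ℝ => x) ν) (h : ConvexOrder μ ν) :
    Tendsto (D μ ν) atTop (𝓝 0) := by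
  have := (tendsto_P_sub_atTop hν).sub (tendsto_P_sub_atTop hμ)
  rw [h.mean_eq hν] at this
  rw [sub_zero] at this
  refine this.congr fun k => ?_
  simp only [D]; ring

end Order

/-! ### Quantiles and the potentials of the truncated measures -/

section Quantile

variable {μ : Measure ℝ} [IsProbabilityMeasure μ]

lemma tendsto_cdf_atBot : Tendsto (fun x => μ.real (Iic x)) atBot (𝓝 0) :=
  (ProbabilityTheory.tendsto_cdf_atBot μ).congr (ProbabilityTheory.cdf_eq_real μ)

lemma tendsto_cdf_atTop : Tendsto (fun x => μ.real (Iic x)) atTop (𝓝 1) :=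
  (ProbabilityTheory.tendsto_cdf_atTop μ).congr (ProbabilityTheory.cdf_eq_real μ)

lemma quantile_nonempty {u : ℝ} (hu : u < 1) : {x : ℝ | u ≤ μ.real (Iic x)}.Nonempty := by
  obtain ⟨x, hx⟩ := ((tendsto_cdf_atTop (μ := μ)).eventually (lt_mem_nhds hu)).exists
  exact ⟨x, le_of_lt hx⟩

lemma quantile_bddBelow {u : ℝ} (hu : 0 < u) : BddBelow {x : ℝ | u ≤ μ.real (Iic x)} := by
  obtain ⟨x, hx⟩ := ((tendsto_cdf_atBot (μ := μ)).eventually (gt_mem_nhds hu)).exists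
  refine ⟨x, fun z hz => ?_⟩
  by_contra h
  have := cdf_mono μ (not_le.1 h).le
  have hz : u ≤ μ.real (Iic z) := hz
  linarith

lemma cdf_lt_of_lt_G {u k : ℝ} (hu : 0 < u) (hk : k < G μ u) : μ.real (Iic k) < u := by
  by_contra h
  exact absurd (csInf_le (quantile_bddBelow hu) (not_lt.1 h)) (not_le.2 hk)

lemma le_cdf_of_G_lt {u k : ℝ} (hu : u < 1) (hk : G μ u < k) : u ≤ μ.real (Iic k) := by
  obtain ⟨x, hx, hxk⟩ := exists_lt_of_csInf_lt (quantile_nonempty hu) hk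
  exact le_trans hx (cdf_mono μ hxk.le)

lemma le_cdf_G {u : ℝ} (hu : u ∈ Ioo (0 : ℝ) 1) : u ≤ μ.real (Iic (G μ u)) := by
  refine ge_of_tendsto (tendsto_cdf_nhdsGT (G μ u)) ?_
  filter_upwards [self_mem_nhdsWithin] with k hk
  exact le_cdf_of_G_lt hu.2 hk

lemma measureReal_Iio_G_le {u : ℝ} (hu : u ∈ Ioo (0 : ℝ) 1) : μ.real (Iio (G μ u)) ≤ u := by
  refine le_of_tendsto (tendsto_cdf_nhdsLT (G μ u)) ?_
  filter_upwards [self_mem_nhdsWithin] with k hk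
  exact (cdf_lt_of_lt_G hu.1 hk).le

lemma G_monotoneOn : MonotoneOn (G μ) (Ioo (0 : ℝ) 1) := fun _ hu _ hv huv =>
  csInf_le_csInf (quantile_bddBelow hu.1) (quantile_nonempty hv.2) fun _ hx => le_trans huv hx

/-- The level `u` is a subgradient of the potential at the quantile `G u`. -/
lemma level_mul_le_P_sub (hμ : Integrable (fun x : ℝ => x) μ) {u : ℝ} (hu : u ∈ Ioo (0 : ℝ) 1)
    (k : ℝ) : u * (k - G μ u) ≤ P μ k - P μ (G μ u) := by
  have h1 := cdf_mul_le_P_sub (integrable_max hμ) (G μ u) k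
  have h2 := measureReal_Iio_mul_le_P_sub (integrable_max hμ) (G μ u) k
  have h3 := le_cdf_G (μ := μ) hu
  have h4 := measureReal_Iio_G_le (μ := μ) hu
  rcases le_total (G μ u) k with h | h
  · nlinarith [sub_nonneg.2 h]
  · nlinarith [sub_nonneg.2 h]

lemma P_lower (hμ : Integrable (fun x : ℝ => x) μ) {u : ℝ} (hu : u ∈ Ioo (0 : ℝ) 1) (k : ℝ) :
    P (lower μ u) k = ∫ x in Iio (G μ u), max (k - x) 0 ∂μ +
      (u - μ.real (Iio (G μ u))) * max (k - G μ u) 0 := by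
  rw [P, lower, integral_add_measure (integrable_max hμ k).integrableOn
    ((integrable_dirac (by simp)).smul_measure ENNReal.ofReal_ne_top),
    integral_smul_measure, integral_dirac,
    ENNReal.toReal_ofReal (sub_nonneg.2 (measureReal_Iio_G_le hu)), smul_eq_mul]

/-- To the left of the quantile the potential of `lower μ u` is that of `μ`. -/
lemma P_lower_of_le (hμ : Integrable (fun x : ℝ => x) μ) {u : ℝ} (hu : u ∈ Ioo (0 : ℝ) 1)
    {k : ℝ} (hk : k ≤ G μ u) : P (lower μ u) k = P μ k := by
  rw [P_lower hμ hu, max_eq_right (by linarith : k - G μ u ≤ 0), mul_zero, add_zero, P]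
  refine setIntegral_eq_integral_of_forall_compl_eq_zero fun x hx => ?_
  have : G μ u ≤ x := not_lt.1 hx
  exact max_eq_right (by linarith)

/-- To the right of the quantile the potential of `lower μ u` is the tangent of slope `u`. -/
lemma P_lower_of_ge (hμ : Integrable (fun x : ℝ => x) μ) {u : ℝ} (hu : u ∈ Ioo (0 : ℝ) 1)
    {k : ℝ} (hk : G μ u ≤ k) : P (lower μ u) k = P μ (G μ u) + u * (k - G μ u) := by
  have h0 := P_lower hμ hu (G μ u)
  rw [P_lower_of_le hμ hu le_rfl, sub_self, max_self, mul_zero, add_zero] at h0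
  rw [P_lower hμ hu, max_eq_left (by linarith : 0 ≤ k - G μ u), h0]
  have h1 : ∫ x in Iio (G μ u), max (k - x) 0 ∂μ =
      ∫ x in Iio (G μ u), (max (G μ u - x) 0 + (k - G μ u)) ∂μ := by
    refine setIntegral_congr_fun measurableSet_Iio fun x hx => ?_
    have : x < G μ u := hx
    rw [max_eq_left (by linarith), max_eq_left (by linarith)]; ring
  rw [h1, integral_add (integrable_max hμ _).integrableOn (integrable_const _), setIntegral_const,
    smul_eq_mul]
  ring

variable (hμ : Integrable (fun x : ℝ => x) μ)
include hμ

lemma P_lower_eq_max {u : ℝ} (hu : u ∈ Ioo (0 : ℝ) 1) (k : ℝ) :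
    P (lower μ u) k = P μ (min k (G μ u)) + u * max (k - G μ u) 0 := by
  rcases le_total k (G μ u) with h | h
  · rw [P_lower_of_le hμ hu h, min_eq_left h, max_eq_right (by linarith), mul_zero, add_zero]
  · rw [P_lower_of_ge hμ hu h, min_eq_right h, max_eq_left (by linarith)]

lemma P_lower_le_P {u : ℝ} (hu : u ∈ Ioo (0 : ℝ) 1) (k : ℝ) : P (lower μ u) k ≤ P μ k := by
  rcases le_total k (G μ u) with h | h
  · exact (P_lower_of_le hμ hu h).le
  · rw [P_lower_of_ge hμ hu h]
    linarith [level_mul_le_P_sub hμ hu k]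

/-- The increments of `P` to the left of the quantile have slope at most `u`. -/
lemma P_sub_le_level {u k l : ℝ} (hu : u ∈ Ioo (0 : ℝ) 1) (hk : l ≤ k) (hkG : k ≤ G μ u) :
    P μ k - P μ l ≤ u * (k - l) := by
  have h2 := measureReal_Iio_mul_le_P_sub (integrable_max hμ) k l
  have h4 := (measureReal_mono (Iio_subset_Iio hkG)).trans (measureReal_Iio_G_le (μ := μ) hu)
  nlinarith [sub_nonneg.2 hk]

/-- The increment from `u` to `v` is morally the integral of `(k - G w)⁺` over `w` in `(u, v)`.
Monotonicity of `G` bounds the integrand by its values at the endpoints; this bound and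
`P_lower_sub_le` squeeze the difference quotient in `u`. -/
lemma le_P_lower_sub {u v : ℝ} (hu : u ∈ Ioo (0 : ℝ) 1) (hv : v ∈ Ioo (0 : ℝ) 1) (huv : u ≤ v)
    (k : ℝ) : (v - u) * max (k - G μ v) 0 ≤ P (lower μ v) k - P (lower μ u) k := by
  have hG := G_monotoneOn (μ := μ) hu hv huv
  rcases le_total k (G μ v) with h | h
  · rw [max_eq_right (by linarith), mul_zero, P_lower_of_le hμ hv h]
    linarith [P_lower_le_P hμ hu k]
  · rw [max_eq_left (by linarith), P_lower_of_ge hμ hv h, P_lower_of_ge hμ hu (hG.trans h)]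
    linarith [level_mul_le_P_sub hμ hu (G μ v)]

lemma P_lower_sub_le {u v : ℝ} (hu : u ∈ Ioo (0 : ℝ) 1) (hv : v ∈ Ioo (0 : ℝ) 1) (huv : u ≤ v)
    (k : ℝ) : P (lower μ v) k - P (lower μ u) k ≤ (v - u) * max (k - G μ u) 0 := by
  have hG := G_monotoneOn (μ := μ) hu hv huv
  rcases le_total k (G μ u) with h | h
  · rw [max_eq_right (by linarith), mul_zero, P_lower_of_le hμ hu h,
      P_lower_of_le hμ hv (h.trans hG), sub_self]
  rw [max_eq_left (by linarith), P_lower_of_ge hμ hu h]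
  rcases le_total k (G μ v) with h' | h'
  · rw [P_lower_of_le hμ hv h']
    linarith [P_sub_le_level hμ hv h h']
  · rw [P_lower_of_ge hμ hv h']
    linarith [P_sub_le_level hμ hv hG le_rfl]

lemma P_lower_mono_level {u v : ℝ} (hu : u ∈ Ioo (0 : ℝ) 1) (hv : v ∈ Ioo (0 : ℝ) 1) (huv : u ≤ v)
    (k : ℝ) : P (lower μ u) k ≤ P (lower μ v) k := by
  have := le_P_lower_sub hμ hu hv huv k
  have := mul_nonneg (sub_nonneg.2 huv) (le_max_right (k - G μ v) 0)
  linarith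

/-- The potential of `lower μ u` lies below `P μ` at `l` and has slope at most `u`. The free point
`l` is sent to `-∞` when `u → 0`. -/
lemma P_lower_le_P_add {u : ℝ} (hu : u ∈ Ioo (0 : ℝ) 1) (k l : ℝ) :
    P (lower μ u) k ≤ P μ l + u * max (k - l) 0 := by
  have hm := P_mono (integrable_max hμ)
  rcases le_total k (G μ u) with h | h
  · rw [P_lower_of_le hμ hu h]
    rcases le_total k l with h' | h'
    · have := hm h'
      have := mul_nonneg hu.1.le (le_max_right (k - l) 0)
      linarith
    · rw [max_eq_left (by linarith)]
      linarith [P_sub_le_level hμ hu h' h]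
  · rw [P_lower_of_ge hμ hu h]
    have := mul_le_mul_of_nonneg_left (le_max_left (k - l) 0) hu.1.le
    linarith [level_mul_le_P_sub hμ hu l]

/-- The mass omitted from `lower μ u` is `1 - u`, and none of it lies to the left of `G u`. The
bound is used as `u → 1`. -/
lemma P_sub_P_lower_le {u : ℝ} (hu : u ∈ Ioo (0 : ℝ) 1) (k : ℝ) :
    P μ k - P (lower μ u) k ≤ (1 - u) * max (k - G μ u) 0 := by
  rcases le_total k (G μ u) with h | h
  · rw [P_lower_of_le hμ hu h, max_eq_right (by linarith)]; simp
  · rw [P_lower_of_ge hμ hu h, max_eq_left (by linarith)]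
    have h1 := P_sub_le (integrable_max hμ) (G μ u) k
    have h2 : μ.real (Iic k) ≤ 1 := measureReal_le_one
    nlinarith [sub_nonneg.2 h]

/-- The distribution function of `lower μ u` is the minimum of `u` and that of `μ`. -/
lemma subgradient_P_lower {u : ℝ} (hu : u ∈ Ioo (0 : ℝ) 1) (k l : ℝ) :
    min u (μ.real (Iic k)) * (l - k) ≤ P (lower μ u) l - P (lower μ u) k := by
  rcases le_or_gt (G μ u) k with h | h
  · have h1 := (le_cdf_G hu).trans (cdf_mono μ h)
    rw [min_eq_left h1, P_lower_of_ge hμ hu h]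
    rcases le_total l (G μ u) with h' | h'
    · rw [P_lower_of_le hμ hu h']
      linarith [level_mul_le_P_sub hμ hu l]
    · rw [P_lower_of_ge hμ hu h']
      linarith
  · rw [min_eq_right (cdf_lt_of_lt_G hu.1 h).le, P_lower_of_le hμ hu h.le]
    rcases le_total l (G μ u) with h' | h'
    · rw [P_lower_of_le hμ hu h']
      exact cdf_mul_le_P_sub (integrable_max hμ) k l
    · rw [P_lower_of_ge hμ hu h']
      have h1 := cdf_mul_le_P_sub (integrable_max hμ) k (G μ u)
      have h2 := cdf_lt_of_lt_G hu.1 h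
      nlinarith [sub_nonneg.2 h']

/-- The increments of `u ↦ P (lower μ u)` are convex. -/
lemma convexOn_P_lower_sub {u v : ℝ} (hu : u ∈ Ioo (0 : ℝ) 1) (hv : v ∈ Ioo (0 : ℝ) 1)
    (huv : u ≤ v) : ConvexOn ℝ univ fun k => P (lower μ v) k - P (lower μ u) k := by
  have hG := G_monotoneOn (μ := μ) hu hv huv
  -- The difference is the potential of the positive measure `lower μ v - lower μ u`, whose
  -- distribution function supplies the subgradients: `0` to the left of `G u`, and `min v F - u` to
  -- the right, with `F` that of `μ`.
  have key : ∀ k, ∃ c, ∀ l, c * (l - k) ≤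
      (P (lower μ v) l - P (lower μ u) l) - (P (lower μ v) k - P (lower μ u) k) := by
    intro k
    rcases le_total k (G μ u) with h | h
    · refine ⟨0, fun l => ?_⟩
      rw [P_lower_of_le hμ hu h, P_lower_of_le hμ hv (h.trans hG)]
      linarith [P_lower_mono_level hμ hu hv huv l]
    · refine ⟨min v (μ.real (Iic k)) - u, fun l => ?_⟩
      have h1 := subgradient_P_lower hμ hv k l
      have h2 := P_lower_of_ge hμ hu h
      rcases le_total (G μ u) l with h' | h'
      · rw [P_lower_of_ge hμ hu h', h2]
        linarith
      · rw [P_lower_of_le hμ hu h', P_lower_of_le hμ hv (h'.trans hG), h2]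
        have h3 := level_mul_le_P_sub hμ hv (G μ u)
        have h4 := (le_cdf_G hu).trans (cdf_mono μ h)
        have h5 : u ≤ min v (μ.real (Iic k)) := le_min huv h4
        have h6 := subgradient_P_lower hμ hv k (G μ u)
        rw [P_lower_of_le hμ hv hG] at h6
        nlinarith
  refine ⟨convex_univ, fun x _ z _ a b ha hb hab => ?_⟩
  obtain ⟨c, hc⟩ := key (a • x + b • z)
  have h1 := mul_le_mul_of_nonneg_left (hc x) ha
  have h2 := mul_le_mul_of_nonneg_left (hc z) hb
  simp only [smul_eq_mul] at *
  have hb' : b = 1 - a := by linarith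
  subst hb'
  nlinarith

lemma continuous_P_lower {u : ℝ} (hu : u ∈ Ioo (0 : ℝ) 1) : Continuous (P (lower μ u)) := by
  have : P (lower μ u) = fun k => P μ (min k (G μ u)) + u * max (k - G μ u) 0 :=
    funext (P_lower_eq_max hμ hu)
  rw [this]
  have := continuous_P (integrable_max hμ)
  fun_prop

/-- The derivative of the potential of `lower μ u` in the level `u`. -/
lemma hasDerivAt_P_lower {u : ℝ} (hu : u ∈ Ioo (0 : ℝ) 1) (hc : ContinuousAt (G μ) u) (k : ℝ) :
    HasDerivAt (fun v => P (lower μ v) k) (max (k - G μ u) 0) u := by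
  have hq : Tendsto (fun v => max (k - G μ v) 0) (𝓝[≠] u) (𝓝 (max (k - G μ u) 0)) :=
    ((tendsto_const_nhds.sub hc.tendsto).max tendsto_const_nhds).mono_left nhdsWithin_le_nhds
  have hn : ∀ᶠ v in 𝓝[≠] u, v ∈ Ioo (0 : ℝ) 1 :=
    nhdsWithin_le_nhds (Ioo_mem_nhds hu.1 hu.2)
  rw [hasDerivAt_iff_tendsto_slope]
  have hq1 : Tendsto (fun v => min (max (k - G μ u) 0) (max (k - G μ v) 0)) (𝓝[≠] u)
      (𝓝 (max (k - G μ u) 0)) := by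
    simpa using (tendsto_const_nhds (x := max (k - G μ u) 0)).min hq
  have hq2 : Tendsto (fun v => max (max (k - G μ u) 0) (max (k - G μ v) 0)) (𝓝[≠] u)
      (𝓝 (max (k - G μ u) 0)) := by
    simpa using (tendsto_const_nhds (x := max (k - G μ u) 0)).max hq
  refine tendsto_of_tendsto_of_tendsto_of_le_of_le' hq1 hq2 ?_ ?_
  · filter_upwards [hn, self_mem_nhdsWithin] with v hv hne
    rcases lt_or_gt_of_ne (show v ≠ u from hne) with h | h
    · rw [slope_comm, slope_def_field, le_div_iff₀ (by linarith)]
      have := le_P_lower_sub hμ hv hu h.le k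
      nlinarith [min_le_left (max (k - G μ u) 0) (max (k - G μ v) 0)]
    · rw [slope_def_field, le_div_iff₀ (by linarith)]
      have := le_P_lower_sub hμ hu hv h.le k
      nlinarith [min_le_right (max (k - G μ u) 0) (max (k - G μ v) 0)]
  · filter_upwards [hn, self_mem_nhdsWithin] with v hv hne
    rcases lt_or_gt_of_ne (show v ≠ u from hne) with h | h
    · rw [slope_comm, slope_def_field, div_le_iff₀ (by linarith)]
      have := P_lower_sub_le hμ hv hu h.le k
      nlinarith [le_max_right (max (k - G μ u) 0) (max (k - G μ v) 0)]
    · rw [slope_def_field, div_le_iff₀ (by linarith)]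
      have := P_lower_sub_le hμ hu hv h.le k
      nlinarith [le_max_left (max (k - G μ u) 0) (max (k - G μ v) 0)]

end Quantile

/-! ### Supporting lines of convex functions -/

section Convex

variable {h : ℝ → ℝ}

lemma exists_subgradient (hh : ConvexOn ℝ univ h) (x : ℝ) :
    ∃ θ, ∀ z, h x + θ * (z - x) ≤ h z := by
  have hx : x ∈ interior (univ : Set ℝ) := by simp
  refine ⟨derivWithin h (Ioi x) x, fun z => ?_⟩
  rcases lt_trichotomy x z with hz | rfl | hz
  · have := hh.rightDeriv_le_slope_of_mem_interior hx (mem_univ z) hz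
    rw [slope_def_field, le_div_iff₀ (by linarith)] at this
    linarith
  · simp
  · have h1 := hh.slope_le_leftDeriv_of_mem_interior (mem_univ z) hx hz
    have h2 := h1.trans (hh.leftDeriv_le_rightDeriv_of_mem_interior hx)
    rw [slope_def_field, div_le_iff₀ (by linarith)] at h2
    linarith

lemma continuous_of_convexOn (hh : ConvexOn ℝ univ h) : Continuous h := by
  simpa [continuousOn_univ] using hh.continuousOn_interior

/-- A convex function that lies below a line at `x` and not below it at `b` lies above the line
beyond `b`. -/
lemma affine_lt_of_lt (hh : ConvexOn ℝ univ h) {c θ a x b z : ℝ} (hx : h x < c + θ * (x - a))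
    (hb : c + θ * (b - a) ≤ h b) (hz : (x < b ∧ b < z) ∨ (z < b ∧ b < x)) :
    c + θ * (z - a) < h z := by
  obtain ⟨ξ, hξ⟩ := exists_subgradient hh b
  have h1 := hξ x
  have h2 := hξ z
  rcases hz with ⟨hxb, hbz⟩ | ⟨hzb, hbx⟩
  · have : θ < ξ := by
      by_contra hc
      nlinarith [not_lt.1 hc]
    nlinarith
  · have : ξ < θ := by
      by_contra hc
      nlinarith [not_lt.1 hc]
    nlinarith

end Convex

/-! ### Convex hulls and their points of contact -/

section Hull

variable {f : ℝ → ℝ}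

lemma hull_bddAbove (f : ℝ → ℝ) (k : ℝ) :
    BddAbove {z : ℝ | ∃ g : ℝ → ℝ, ConvexOn ℝ univ g ∧ (∀ x, g x ≤ f x) ∧ g k = z} :=
  ⟨f k, by rintro z ⟨g, _, hg, rfl⟩; exact hg k⟩

lemma le_hull {g : ℝ → ℝ} (hg : ConvexOn ℝ univ g) (hgf : ∀ x, g x ≤ f x) (k : ℝ) :
    g k ≤ hull f k :=
  le_csSup (hull_bddAbove f k) ⟨g, hg, hgf, rfl⟩

lemma convexOn_affine (c θ a : ℝ) : ConvexOn ℝ univ fun x : ℝ => c + θ * (x - a) := by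
  refine ⟨convex_univ, fun x _ z _ s t _ _ hst => le_of_eq ?_⟩
  simp only [smul_eq_mul]
  obtain rfl : t = 1 - s := by linarith
  ring

lemma affine_le_hull {c θ a : ℝ} (hf : ∀ x, c + θ * (x - a) ≤ f x) (k : ℝ) :
    c + θ * (k - a) ≤ hull f k :=
  le_hull (convexOn_affine c θ a) hf k

variable (hf : ∀ x, 0 ≤ f x)
include hf

lemma hull_nonempty (k : ℝ) :
    {z : ℝ | ∃ g : ℝ → ℝ, ConvexOn ℝ univ g ∧ (∀ x, g x ≤ f x) ∧ g k = z}.Nonempty :=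
  ⟨0, fun _ => 0, convexOn_const 0 convex_univ, hf, rfl⟩

lemma hull_nonneg (k : ℝ) : 0 ≤ hull f k :=
  le_hull (convexOn_const 0 convex_univ) hf k

lemma hull_le (k : ℝ) : hull f k ≤ f k :=
  csSup_le (hull_nonempty hf k) (by rintro z ⟨g, _, hg, rfl⟩; exact hg k)

lemma convexOn_hull : ConvexOn ℝ univ (hull f) := by
  refine ⟨convex_univ, fun x _ z _ a b ha hb hab => csSup_le (hull_nonempty hf _) ?_⟩
  rintro w ⟨g, hg, hgf, rfl⟩
  refine (hg.2 (mem_univ x) (mem_univ z) ha hb hab).trans ?_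
  exact add_le_add (smul_le_smul_of_nonneg_left (le_hull hg hgf x) ha)
    (smul_le_smul_of_nonneg_left (le_hull hg hgf z) hb)

/-- To the left of a contact point `b` of `f` with its hull, the hull only depends on the values of
`f` on `(-∞, b]`. -/
lemma hull_le_hull_add {f' : ℝ → ℝ} (hf' : ∀ x, 0 ≤ f' x) {b y ε : ℝ} (hyb : y ≤ b)
    (hb : hull f' b = f' b) (hle : ∀ x ≤ b, f x ≤ f' x + ε) : hull f y ≤ hull f' y + ε := by
  by_contra hlt
  obtain ⟨θ, hθ⟩ := exists_subgradient (convexOn_hull hf) y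
  -- A supporting line of `hull f` at `y`, lowered by `ε`, is below `f'` on `(-∞, b]`. By assumption
  -- it exceeds `hull f'` at `y`, but it does not at the contact point `b`, so by convexity it stays
  -- below `hull f'` beyond `b`. It is then an affine minorant of `f'` exceeding `hull f'` at `y`,
  -- which is absurd.
  have hθf : ∀ x, (hull f y - ε) + θ * (x - y) ≤ f' x := by
    intro x
    rcases le_or_gt x b with hx | hx
    · linarith [hle x hx, hθ x, hull_le hf x]
    · have hb' : (hull f y - ε) + θ * (b - y) ≤ hull f' b := by
        rw [hb]; linarith [hle b le_rfl, hθ b, hull_le hf b]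
      have hy' : hull f' y < (hull f y - ε) + θ * (y - y) := by
        rw [sub_self, mul_zero]; linarith
      rcases hyb.eq_or_lt with rfl | hyb
      · linarith
      · exact ((affine_lt_of_lt (convexOn_hull hf') hy' hb' (.inl ⟨hyb, hx⟩)).le).trans
          (hull_le hf' x)
  have := affine_le_hull hθf y
  rw [sub_self, mul_zero] at this
  linarith

omit hf

/-- A line below `f` that cannot be raised at `g`, and from which `f` grows away linearly at
`∞`, touches `f` to the right of `g`. -/
lemma exists_contact_right (hfc : Continuous f) {c φ g t₀ K : ℝ}
    (hL : ∀ k, c + φ * (k - g) ≤ f k) (hmax : ∀ c' s, (∀ k, c' + s * (k - g) ≤ f k) → c' ≤ c)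
    (ht₀ : 0 < t₀) (hK : ∀ k ≥ K, t₀ * (k - g) ≤ f k - (c + φ * (k - g))) :
    ∃ z, g ≤ z ∧ f z = c + φ * (z - g) := by
  by_contra! hne
  have hpos : ∀ k, g ≤ k → 0 < f k - (c + φ * (k - g)) := fun k hk =>
    sub_pos.2 (lt_of_le_of_ne (hL k) (Ne.symm (hne k hk)))
  have hdc : Continuous fun k => f k - (c + φ * (k - g)) := by fun_prop
  obtain ⟨η, hη, hball⟩ : ∃ η > 0, ∀ k, |k - g| ≤ η → 0 < f k - (c + φ * (k - g)) := by
    have := hdc.continuousAt.eventually (lt_mem_nhds (hpos g le_rfl))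
    obtain ⟨η, hη, hs⟩ := Metric.eventually_nhds_iff.1 this
    refine ⟨η / 2, by positivity, fun k hk => hs ?_⟩
    rw [Real.dist_eq]; linarith
  set K' := max K (g + η) with hK'
  have hK'1 : K ≤ K' := le_max_left _ _
  have hK'2 : g + η ≤ K' := le_max_right _ _
  obtain ⟨x₀, hx₀, hmin⟩ := isCompact_Icc.exists_isMinOn
    (nonempty_Icc.2 (by linarith : g - η ≤ K')) hdc.continuousOn
  have hpos' : ∀ k, g - η ≤ k → 0 < f k - (c + φ * (k - g)) := by
    intro k hk
    rcases le_total g k with h | h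
    · exact hpos k h
    · exact hball k (by rw [abs_of_nonpos (by linarith)]; linarith)
  set m := f x₀ - (c + φ * (x₀ - g)) with hm
  have hm0 : 0 < m := hpos' x₀ hx₀.1
  have hlen : 0 < K' - g + η := by linarith
  -- The line is turned about the point of abscissa `g - η`, that is, `t * (k - (g - η))` is added
  -- to it. To the left this lowers it, on `[g - η, K']` the gap `m` leaves room, and beyond `K'`
  -- one has `k - g + η ≤ 2 * (k - g)`, whence the bound `t₀ / 2`. The new line is higher at `g`,
  -- against maximality.
  set t := min (m / (K' - g + η)) (t₀ / 2) with ht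
  have ht0 : 0 < t := lt_min (div_pos hm0 hlen) (by linarith)
  have ht1 : t * (K' - g + η) ≤ m := (le_div_iff₀ hlen).1 (min_le_left _ _)
  have ht2 : t ≤ t₀ / 2 := min_le_right _ _
  have := hmax (c + t * η) (φ + t) fun k => by
    rcases le_total k (g - η) with h | h
    · nlinarith [hL k]
    rcases le_total k K' with h' | h'
    · have := isMinOn_iff.1 hmin k ⟨h, h'⟩
      nlinarith
    · have := hK k (hK'1.trans h')
      nlinarith
  nlinarith [mul_pos ht0 hη]

lemma exists_contact_left (hfc : Continuous f) {c φ g t₀ K : ℝ}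
    (hL : ∀ k, c + φ * (k - g) ≤ f k) (hmax : ∀ c' s, (∀ k, c' + s * (k - g) ≤ f k) → c' ≤ c)
    (ht₀ : 0 < t₀) (hK : ∀ k ≤ K, t₀ * (g - k) ≤ f k - (c + φ * (k - g))) :
    ∃ z, z ≤ g ∧ f z = c + φ * (z - g) := by
  obtain ⟨z, hz, hfz⟩ := exists_contact_right (f := fun x => f (-x)) (c := c) (φ := -φ) (g := -g)
    (t₀ := t₀) (K := -K) (by fun_prop)
    (fun k => by have := hL (-k); linarith)
    (fun c' s hs => hmax c' (-s) fun k => by have := hs (-k); rw [neg_neg] at this; linarith)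
    ht₀ (fun k hk => by have := hK (-k) (by linarith); linarith)
  exact ⟨-z, by linarith, by rw [hfz]; ring⟩

end Hull

/-- A convex function that lies above a line and touches it at two points agrees with it between
them. -/
lemma eq_affine_of_touch {h : ℝ → ℝ} (hh : ConvexOn ℝ univ h) {c θ g a b k : ℝ}
    (hL : ∀ k, c + θ * (k - g) ≤ h k) (ha : h a = c + θ * (a - g)) (hb : h b = c + θ * (b - g))
    (hk : k ∈ Icc a b) : h k = c + θ * (k - g) := by
  refine le_antisymm ?_ (hL k)
  by_contra hlt
  obtain ⟨ξ, hξ⟩ := exists_subgradient hh k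
  have h1 := hξ a
  have h2 := hξ b
  rcases le_total θ ξ with h | h
  · nlinarith [hk.1, hk.2]
  · nlinarith [hk.1, hk.2]

/-! ### The hull of `E u`: contact points, `S`, `R` and exceptional levels -/

section Excess

variable {μ ν : Measure ℝ} [IsProbabilityMeasure μ] (hμ : Integrable (fun x : ℝ => x) μ)
include hμ

lemma E_eq_D {u : ℝ} (hu : u ∈ Ioo (0 : ℝ) 1) {k : ℝ} (hk : k ≤ G μ u) :
    E μ ν u k = D μ ν k := by
  rw [E, D, P_lower_of_le hμ hu hk]

lemma E_of_ge {u : ℝ} (hu : u ∈ Ioo (0 : ℝ) 1) {k : ℝ} (hk : G μ u ≤ k) :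
    E μ ν u k = P ν k - P μ (G μ u) - u * (k - G μ u) := by
  rw [E, P_lower_of_ge hμ hu hk]; ring

lemma D_le_E {u : ℝ} (hu : u ∈ Ioo (0 : ℝ) 1) (k : ℝ) : D μ ν k ≤ E μ ν u k :=
  sub_le_sub_left (P_lower_le_P hμ hu k) _

lemma E_antitone {u v : ℝ} (hu : u ∈ Ioo (0 : ℝ) 1) (hv : v ∈ Ioo (0 : ℝ) 1) (huv : u ≤ v)
    (k : ℝ) : E μ ν v k ≤ E μ ν u k :=
  sub_le_sub_left (P_lower_mono_level hμ hu hv huv k) _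

variable [IsProbabilityMeasure ν] (hν : Integrable (fun x : ℝ => x) ν) (hcx : ConvexOrder μ ν)

include hν in
lemma continuous_E {u : ℝ} (hu : u ∈ Ioo (0 : ℝ) 1) : Continuous (E μ ν u) :=
  (continuous_P (integrable_max hν)).sub (continuous_P_lower hμ hu)

include hν hcx

lemma E_nonneg {u : ℝ} (hu : u ∈ Ioo (0 : ℝ) 1) (k : ℝ) : 0 ≤ E μ ν u k :=
  (hcx.D_nonneg hν k).trans (D_le_E hμ hu k)

lemma continuous_hull_E {u : ℝ} (hu : u ∈ Ioo (0 : ℝ) 1) : Continuous (hull (E μ ν u)) :=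
  continuous_of_convexOn (convexOn_hull (E_nonneg hμ hν hcx hu))

omit hcx in
lemma exists_touch_right {u : ℝ} (hu : u ∈ Ioo (0 : ℝ) 1) {θ : ℝ} (hθ : θ < 1 - u)
    (hL : ∀ k, hull (E μ ν u) (G μ u) + θ * (k - G μ u) ≤ E μ ν u k) :
    ∃ z, G μ u ≤ z ∧ E μ ν u z = hull (E μ ν u) (G μ u) + θ * (z - G μ u) := by
  set c := hull (E μ ν u) (G μ u) with hc
  -- Since `P ν k` is at least `k` minus the mean, the gap to the line at `k ≥ G u` is at least `(1
  -- - u - θ) * (k - G u) - A`; the threshold `K` makes half of the linear term absorb `A`.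
  set A := P μ (G μ u) + c + ∫ x, x ∂ν - G μ u with hA
  refine exists_contact_right (continuous_E hμ hν hu) (t₀ := (1 - u - θ) / 2)
    (K := max (G μ u) (G μ u + 2 * A / (1 - u - θ))) hL (fun c' s hs => ?_) (by linarith)
    fun k hk => ?_
  · have := affine_le_hull hs (G μ u)
    rwa [sub_self, mul_zero, add_zero] at this
  · have h1 : G μ u ≤ k := (le_max_left _ _).trans hk
    have h2 : 2 * A / (1 - u - θ) ≤ k - G μ u := by
      have := (le_max_right _ _).trans hk
      linarith
    rw [div_le_iff₀ (by linarith)] at h2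
    rw [E_of_ge hμ hu h1]
    have := sub_mean_le_P hν k
    nlinarith

omit hcx in
-- At `-∞` the function `E u` agrees with `D`, which tends to `0`, whereas a line with slope `≤ 0`
-- would stay above `c > 0` there.
lemma slope_pos {u : ℝ} (hu : u ∈ Ioo (0 : ℝ) 1) {θ c : ℝ} (hc : 0 < c)
    (hL : ∀ k, c + θ * (k - G μ u) ≤ E μ ν u k) : 0 < θ := by
  by_contra hθ
  have : c ≤ 0 := by
    refine ge_of_tendsto (tendsto_D_atBot hμ hν) ?_
    filter_upwards [eventually_le_atBot (G μ u)] with k hk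
    rw [← E_eq_D hμ hu hk]
    nlinarith [hL k]
  linarith

lemma exists_touch_left {u : ℝ} (hu : u ∈ Ioo (0 : ℝ) 1) (hpos : 0 < hull (E μ ν u) (G μ u))
    {θ : ℝ} (hL : ∀ k, hull (E μ ν u) (G μ u) + θ * (k - G μ u) ≤ E μ ν u k) :
    ∃ z, z ≤ G μ u ∧ D μ ν z = hull (E μ ν u) (G μ u) + θ * (z - G μ u) := by
  have hθ := slope_pos hμ hν hu hpos hL
  set c := hull (E μ ν u) (G μ u) with hc
  obtain ⟨z, hz, hEz⟩ := exists_contact_left (continuous_E hμ hν hu) (t₀ := θ / 2)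
    (K := G μ u - 2 * c / θ) hL (fun c' s hs => by
      have := affine_le_hull hs (G μ u)
      rwa [sub_self, mul_zero, add_zero] at this) (by linarith)
    fun k hk => by
      have h2 : 2 * c / θ ≤ G μ u - k := by linarith
      rw [div_le_iff₀ hθ] at h2
      have := E_nonneg hμ hν hcx hu k
      nlinarith
  exact ⟨z, hz, by rw [← E_eq_D hμ hu hz, hEz]⟩

/-- A supporting line of the hull at `G u` has slope below the slope `1 - u` of `E u` at `∞`. -/
lemma slope_lt {u : ℝ} (hu : u ∈ Ioo (0 : ℝ) 1) {θ c a : ℝ} (ha : a < G μ u)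
    (haD : D μ ν a = c + θ * (a - G μ u)) (hL : ∀ k, c + θ * (k - G μ u) ≤ E μ ν u k) :
    θ < 1 - u := by
  by_contra hθ
  -- The line runs through `(a, D a)`; if its slope were at least `1 - u`, comparison with `E u` as
  -- `k → ∞` would give this bound. Its left side is the sum of `D a ≥ 0`, of `(1 - u) * (G u - a) >
  -- 0` and of `P μ (G u)` minus (`G u` minus the mean), which is nonnegative because the means
  -- agree.
  have h1 : D μ ν a - (1 - u) * a + P μ (G μ u) - u * G μ u + ∫ x, x ∂ν ≤ 0 := by
    refine ge_of_tendsto (tendsto_P_sub_atTop hν) ?_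
    filter_upwards [eventually_ge_atTop (G μ u)] with k hk
    have h := hL k
    rw [E_of_ge hμ hu hk] at h
    nlinarith [mul_le_mul_of_nonneg_right (not_lt.1 hθ) (by linarith : 0 ≤ k - a)]
  have h2 := hcx.D_nonneg hν a
  have h3 := sub_mean_le_P hμ (G μ u)
  rw [hcx.mean_eq hν] at h3
  nlinarith [mul_pos (sub_pos.2 hu.2) (sub_pos.2 ha)]

/-- If the hull is positive and below `E u` at `G u`, every supporting line at `G u` touches `E u`
on both sides. -/
lemma exists_touch {u : ℝ} (hu : u ∈ Ioo (0 : ℝ) 1) (hpos : 0 < hull (E μ ν u) (G μ u))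
    (hlt : hull (E μ ν u) (G μ u) < E μ ν u (G μ u))
    {θ : ℝ} (hL : ∀ k, hull (E μ ν u) (G μ u) + θ * (k - G μ u) ≤ E μ ν u k) :
    (∃ a, a < G μ u ∧ D μ ν a = hull (E μ ν u) (G μ u) + θ * (a - G μ u)) ∧
    ∃ b, G μ u < b ∧ E μ ν u b = hull (E μ ν u) (G μ u) + θ * (b - G μ u) := by
  obtain ⟨a, ha, haD⟩ := exists_touch_left hμ hν hcx hu hpos hL
  have ha' : a < G μ u := by
    refine lt_of_le_of_ne ha ?_
    rintro rfl
    rw [← E_eq_D hμ hu ha, sub_self, mul_zero, add_zero] at haD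
    exact hlt.ne' haD
  obtain ⟨b, hb, hbE⟩ := exists_touch_right hμ hν hu (slope_lt hμ hν hcx hu ha' haD hL) hL
  refine ⟨⟨a, ha', haD⟩, b, lt_of_le_of_ne hb ?_, hbE⟩
  rintro rfl
  rw [sub_self, mul_zero, add_zero] at hbE
  exact hlt.ne' hbE

lemma exists_zero_of_hull_eq_zero {u : ℝ} (hu : u ∈ Ioo (0 : ℝ) 1)
    (h0 : hull (E μ ν u) (G μ u) = 0) : ∃ z, G μ u ≤ z ∧ E μ ν u z = 0 := by
  obtain ⟨z, hz, hEz⟩ := exists_touch_right hμ hν hu (θ := 0) (by linarith [hu.2])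
    (fun k => by rw [h0]; simpa using E_nonneg hμ hν hcx hu k)
  exact ⟨z, hz, by rw [hEz, h0]; simp⟩

lemma hull_eq_of_touch {u : ℝ} (hu : u ∈ Ioo (0 : ℝ) 1) {c θ g z : ℝ}
    (hL : ∀ k, c + θ * (k - g) ≤ hull (E μ ν u) k) (hz : E μ ν u z = c + θ * (z - g)) :
    hull (E μ ν u) z = E μ ν u z :=
  le_antisymm (hull_le (E_nonneg hμ hν hcx hu) z) (hz ▸ hL z)

lemma S_set_nonempty {u : ℝ} (hu : u ∈ Ioo (0 : ℝ) 1) :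
    {z : ℝ | G μ u ≤ z ∧ hull (E μ ν u) z = E μ ν u z}.Nonempty := by
  have hn := E_nonneg hμ hν hcx hu
  rcases (hull_le hn (G μ u)).eq_or_lt with h | hlt
  · exact ⟨_, le_rfl, h⟩
  rcases (hull_nonneg hn (G μ u)).eq_or_lt with h0 | hpos
  · obtain ⟨z, hz, hz0⟩ := exists_zero_of_hull_eq_zero hμ hν hcx hu h0.symm
    exact ⟨z, hz, le_antisymm (hull_le hn z) (hz0 ▸ hull_nonneg hn z)⟩
  · obtain ⟨θ, hθ⟩ := exists_subgradient (convexOn_hull hn) (G μ u)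
    obtain ⟨-, b, hb, hbE⟩ := exists_touch hμ hν hcx hu hpos hlt
      fun k => (hθ k).trans (hull_le hn k)
    exact ⟨b, hb.le, hull_eq_of_touch hμ hν hcx hu hθ hbE⟩

lemma S_mem {u : ℝ} (hu : u ∈ Ioo (0 : ℝ) 1) :
    G μ u ≤ S μ ν u ∧ hull (E μ ν u) (S μ ν u) = E μ ν u (S μ ν u) := by
  have hcl : IsClosed {z : ℝ | G μ u ≤ z ∧ hull (E μ ν u) z = E μ ν u z} :=
    isClosed_Ici.inter (isClosed_eq (continuous_hull_E hμ hν hcx hu) (continuous_E hμ hν hu))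
  exact hcl.csInf_mem (S_set_nonempty hμ hν hcx hu) ⟨G μ u, fun z hz => hz.1⟩

omit hμ hν hcx [IsProbabilityMeasure μ] [IsProbabilityMeasure ν] in
lemma S_le {u z : ℝ} (hz : G μ u ≤ z) (h : hull (E μ ν u) z = E μ ν u z) : S μ ν u ≤ z :=
  csInf_le ⟨G μ u, fun _ hz => hz.1⟩ ⟨hz, h⟩

/-- A point of contact for a level is one for every lower level. -/
lemma contact_of_le {u v : ℝ} (hu : u ∈ Ioo (0 : ℝ) 1) (hv : v ∈ Ioo (0 : ℝ) 1) (huv : u ≤ v)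
    {z : ℝ} (hz : hull (E μ ν v) z = E μ ν v z) : hull (E μ ν u) z = E μ ν u z := by
  refine le_antisymm (hull_le (E_nonneg hμ hν hcx hu) z) ?_
  -- Adding the convex increment of potentials to the hull for `v` gives a convex minorant of `E u`
  -- that equals `E u` at `z`.
  have := le_hull (f := E μ ν u) ((convexOn_hull (E_nonneg hμ hν hcx hv)).add
    (convexOn_P_lower_sub hμ hu hv huv)) (fun x => by
      have := hull_le (E_nonneg hμ hν hcx hv) x
      simp only [E, Pi.add_apply] at *
      linarith) z
  simp only [Pi.add_apply, hz] at this
  simp only [E] at *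
  linarith

lemma S_monotoneOn : MonotoneOn (S μ ν) (Ioo (0 : ℝ) 1) := fun _ hu _ hv huv =>
  S_le ((G_monotoneOn hu hv huv).trans (S_mem hμ hν hcx hv).1)
    (contact_of_le hμ hν hcx hu hv huv (S_mem hμ hν hcx hv).2)

/-- On `[G u, ∞)` the function `E u` is `P ν` minus an affine function, hence convex, and a tangent
at `z` supports it there. If this tangent exceeded `E u` somewhere to the left of `S u`, the hull
would start below it, be at or above it at the contact point `S u`, and so exceed `E u` at `z`. -/
lemma contact_of_S_le {u z : ℝ} (hu : u ∈ Ioo (0 : ℝ) 1) (hz : S μ ν u ≤ z) :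
    hull (E μ ν u) z = E μ ν u z := by
  have hn := E_nonneg hμ hν hcx hu
  obtain ⟨hGS, hS⟩ := S_mem hμ hν hcx hu
  rcases hz.eq_or_lt with rfl | hlt
  · exact hS
  have hT : ∀ k, G μ u ≤ k → E μ ν u z + (ν.real (Iic z) - u) * (k - z) ≤ E μ ν u k := by
    intro k hk
    rw [E_of_ge hμ hu hk, E_of_ge hμ hu (hGS.trans hz)]
    linarith [cdf_mul_le_P_sub (integrable_max hν) z k]
  have hT' : ∀ k, E μ ν u z + (ν.real (Iic z) - u) * (k - z) ≤ E μ ν u k := by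
    intro k
    rcases le_or_gt (S μ ν u) k with h | h
    · exact hT k (hGS.trans h)
    by_contra hlt'
    have h1 := affine_lt_of_lt (convexOn_hull hn) ((hull_le hn k).trans_lt (not_le.1 hlt'))
      (hS ▸ hT _ hGS) (.inl ⟨h, hlt⟩)
    rw [sub_self, mul_zero, add_zero] at h1
    exact absurd (hull_le hn z) (not_le.2 h1)
  refine le_antisymm (hull_le hn z) ?_
  simpa using affine_le_hull hT' z

/-- The levels at which the supporting lines of the hull at `G u` are horizontal and lie strictly
below `D`. There is at most one. -/
lemma exceptional_subsingleton (hD : {k : ℝ | 0 < D μ ν k}.OrdConnected) :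
    {u : ℝ | u ∈ Ioo (0 : ℝ) 1 ∧ hull (E μ ν u) (G μ u) = 0 ∧ 0 < D μ ν (G μ u)}.Subsingleton := by
  have key : ∀ u v, u ∈ Ioo (0 : ℝ) 1 → v ∈ Ioo (0 : ℝ) 1 → hull (E μ ν u) (G μ u) = 0 →
      0 < D μ ν (G μ u) → 0 < D μ ν (G μ v) → ¬ u < v := by
    intro u v hu hv h0 hDu hDv huv
    -- The zero `z` of `E u` is a zero of `D` to the right of `G u`. For `v > u`, nonnegativity of
    -- `E v` at `z` forces `z ≤ G v`, so `D` vanishes between two points where it is positive. This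
    -- is where the interval hypothesis is used.
    obtain ⟨z, hz, hEz⟩ := exists_zero_of_hull_eq_zero hμ hν hcx hu h0
    have hDz : D μ ν z ≤ 0 := hEz ▸ D_le_E hμ hu z
    have h1 := le_P_lower_sub hμ hu hv huv.le z
    have h2 := E_nonneg hμ hν hcx hv z
    simp only [E] at hEz h2
    have h3 : z ≤ G μ v := by
      by_contra hlt
      have h4 : 0 < max (z - G μ v) 0 := lt_max_of_lt_left (by linarith)
      have := mul_pos (sub_pos.2 huv) h4
      linarith
    exact absurd (hD.out hDu hDv ⟨hz, h3⟩) (not_lt.2 hDz)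
  intro u hu v hv
  rcases lt_trichotomy u v with h | h | h
  · exact absurd h (key u v hu.1 hv.1 hu.2.1 hu.2.2 hv.2.2)
  · exact h
  · exact absurd h (key v u hv.1 hu.1 hv.2.1 hv.2.2 hu.2.2)

/-- If the hull is positive and below `E u` at `G u`, then `R u` and `S u` are points of contact
between which the hull is affine. -/
lemma exists_R_eq {u : ℝ} (hu : u ∈ Ioo (0 : ℝ) 1) (hpos : 0 < hull (E μ ν u) (G μ u))
    (hlt : hull (E μ ν u) (G μ u) < E μ ν u (G μ u)) :
    ∃ r θ : ℝ, R μ ν u = r ∧ r < G μ u ∧ G μ u < S μ ν u ∧ hull (E μ ν u) r = E μ ν u r ∧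
      ∀ k ∈ Icc r (S μ ν u), hull (E μ ν u) k = hull (E μ ν u) (G μ u) + θ * (k - G μ u) := by
  have hn := E_nonneg hμ hν hcx hu
  obtain ⟨θ, hθ⟩ := exists_subgradient (convexOn_hull hn) (G μ u)
  have hL := fun k => (hθ k).trans (hull_le hn k)
  obtain ⟨⟨a, ha, haD⟩, b, hb, hbE⟩ := exists_touch hμ hν hcx hu hpos hlt hL
  have hθ0 := slope_pos hμ hν hu hpos hL
  have haE : E μ ν u a = hull (E μ ν u) (G μ u) + θ * (a - G μ u) := by
    rw [E_eq_D hμ hu ha.le, haD]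
  have hha : hull (E μ ν u) a = hull (E μ ν u) (G μ u) + θ * (a - G μ u) := by
    rw [hull_eq_of_touch hμ hν hcx hu hθ haE, haE]
  have hhb : hull (E μ ν u) b = hull (E μ ν u) (G μ u) + θ * (b - G μ u) := by
    rw [hull_eq_of_touch hμ hν hcx hu hθ hbE, hbE]
  -- The hull meets the line at points strictly on both sides of `G u`, so no other slope supports
  -- it and the infimum defining `slope` is `θ`.
  have hsub : subdiff (hull (E μ ν u)) (G μ u) = {θ} := by
    refine subset_antisymm (fun ξ hξ => ?_) (singleton_subset_iff.2 hθ)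
    have h1 := hξ a
    have h2 := hξ b
    rw [hha] at h1
    rw [hhb] at h2
    refine le_antisymm ?_ ?_
    · by_contra h
      nlinarith [not_le.1 h]
    · by_contra h
      nlinarith [not_le.1 h]
  have hslope : slope μ ν u = θ := by rw [slope, hsub, csInf_singleton]
  set A := {k : ℝ | k ≤ G μ u ∧ D μ ν k = hull (E μ ν u) (G μ u) + θ * (k - G μ u)} with hA
  have hDc : Continuous (D μ ν) :=
    (continuous_P (integrable_max hν)).sub (continuous_P (integrable_max hμ))
  have hAc : IsClosed A := isClosed_Iic.inter (isClosed_eq hDc (by fun_prop))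
  -- As `D ≥ 0` and `θ > 0`, contact cannot occur beyond the zero of the line; hence `R u` is real.
  have hAb : BddBelow A := by
    refine ⟨G μ u - hull (E μ ν u) (G μ u) / θ, fun k hk => ?_⟩
    have h1 := hcx.D_nonneg hν k
    rw [hk.2] at h1
    have h2 : G μ u - k ≤ hull (E μ ν u) (G μ u) / θ := by
      rw [le_div_iff₀ hθ0]; linarith
    linarith
  have hmem : sInf A ∈ A := hAc.csInf_mem ⟨a, ha.le, haD⟩ hAb
  have hra : sInf A ≤ a := csInf_le hAb ⟨ha.le, haD⟩
  have hrE : E μ ν u (sInf A) = hull (E μ ν u) (G μ u) + θ * (sInf A - G μ u) := by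
    rw [E_eq_D hμ hu hmem.1, hmem.2]
  obtain ⟨hGS, hS⟩ := S_mem hμ hν hcx hu
  have hSb : S μ ν u ≤ b :=
    S_le hb.le (hull_eq_of_touch hμ hν hcx hu hθ hbE)
  refine ⟨sInf A, θ, ?_, hra.trans_lt ha, lt_of_le_of_ne hGS fun h => ?_,
    hull_eq_of_touch hμ hν hcx hu hθ hrE, fun k hk => ?_⟩
  · rw [R, hslope]
    refine le_antisymm (sInf_le ⟨_, hmem.1, hmem.2, rfl⟩) (le_sInf ?_)
    rintro _ ⟨k, hk, hkD, rfl⟩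
    exact EReal.coe_le_coe_iff.2 (csInf_le hAb ⟨hk, hkD⟩)
  · rw [← h] at hS
    exact hlt.ne hS
  · refine eq_affine_of_touch (convexOn_hull hn) hθ ?_ hhb ⟨hk.1, hk.2.trans hSb⟩
    rw [hull_eq_of_touch hμ hν hcx hu hθ hrE, hrE]

end Excess

/-- The real version of `R`, with value `G u` at the levels where `S u = G u`. -/
noncomputable def lowerPoint (μ ν : Measure ℝ) (u : ℝ) : ℝ :=
  if G μ u < S μ ν u then (R μ ν u).toReal else G μ u

/-- The mass sent to `lowerPoint`. -/
noncomputable def lowerMass (μ ν : Measure ℝ) (u : ℝ) : ℝ :=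
  (S μ ν u - G μ u) / (S μ ν u - lowerPoint μ ν u)

/-- The potential of the law with mass `lowerMass` at `lowerPoint` and the remaining mass at
`S u`. -/
noncomputable def levelPotential (μ ν : Measure ℝ) (y u : ℝ) : ℝ :=
  lowerMass μ ν u * max (y - lowerPoint μ ν u) 0 + (1 - lowerMass μ ν u) * max (y - S μ ν u) 0

/-- A level in `(0, 1)` that is not exceptional and at which the quantile function is
continuous. -/
def IsRegularLevel (μ ν : Measure ℝ) (u : ℝ) : Prop :=
  u ∈ Ioo (0 : ℝ) 1 ∧ ¬ (hull (E μ ν u) (G μ u) = 0 ∧ 0 < D μ ν (G μ u)) ∧ ContinuousAt (G μ) u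

/-! ### Differentiation of the hull in the level, and integration over levels -/

section Level

variable {μ ν : Measure ℝ} [IsProbabilityMeasure μ] [IsProbabilityMeasure ν]
  (hμ : Integrable (fun x : ℝ => x) μ) (hν : Integrable (fun x : ℝ => x) ν)
  (hcx : ConvexOrder μ ν)
include hμ hν hcx

/-- Only the exceptional level, if there is one, and the countably many discontinuities of the
monotone `G` are lost. -/
lemma ae_isRegularLevel (hD : {k : ℝ | 0 < D μ ν k}.OrdConnected) :
    ∀ᵐ u ∂(volume.restrict (Ioo (0 : ℝ) 1)), IsRegularLevel μ ν u := by
  have h1 := (exceptional_subsingleton hμ hν hcx hD).finite.countable.ae_notMem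
    (volume.restrict (Ioo (0 : ℝ) 1))
  have h2 := (G_monotoneOn (μ := μ)).countable_not_continuousWithinAt.ae_notMem
    (volume.restrict (Ioo (0 : ℝ) 1))
  filter_upwards [h1, h2, ae_restrict_mem measurableSet_Ioo] with u hu1 hu2 hu
  refine ⟨hu, fun h => hu1 ⟨hu, h⟩, ?_⟩
  have : ContinuousWithinAt (G μ) (Ioo (0 : ℝ) 1) u := by
    by_contra h
    exact hu2 ⟨hu, h⟩
  exact this.continuousAt (Ioo_mem_nhds hu.1 hu.2)

/-- The structure of the hull at a regular level. -/
lemma IsRegularLevel.cases {u : ℝ} (hu : IsRegularLevel μ ν u) :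
    (S μ ν u = G μ u ∧ lowerPoint μ ν u = G μ u) ∨
    (R μ ν u = lowerPoint μ ν u ∧ lowerPoint μ ν u < G μ u ∧ G μ u < S μ ν u ∧
      hull (E μ ν u) (lowerPoint μ ν u) = E μ ν u (lowerPoint μ ν u) ∧
      ∃ θ : ℝ, ∀ k ∈ Icc (lowerPoint μ ν u) (S μ ν u),
        hull (E μ ν u) k = hull (E μ ν u) (G μ u) + θ * (k - G μ u)) := by
  obtain ⟨hu, hreg, -⟩ := hu
  have hn := E_nonneg hμ hν hcx hu
  obtain ⟨hGS, hS⟩ := S_mem hμ hν hcx hu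
  rcases hGS.eq_or_lt with h | h
  · exact .inl ⟨h.symm, by rw [lowerPoint, if_neg (by rw [← h]; exact lt_irrefl _)]⟩
  · right
    have hlt : hull (E μ ν u) (G μ u) < E μ ν u (G μ u) :=
      lt_of_le_of_ne (hull_le hn _) fun he => absurd (S_le le_rfl he) (not_le.2 h)
    have hpos : 0 < hull (E μ ν u) (G μ u) := by
      refine lt_of_le_of_ne (hull_nonneg hn _) fun he => hreg ⟨he.symm, ?_⟩
      rw [← E_eq_D hμ hu le_rfl]
      exact he ▸ hlt
    obtain ⟨r, θ, hr, hrG, -, hrE, haff⟩ := exists_R_eq hμ hν hcx hu hpos hlt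
    have hl : lowerPoint μ ν u = r := by rw [lowerPoint, if_pos h, hr, EReal.toReal_coe]
    rw [hl]
    exact ⟨hr, hrG, h, hrE, θ, haff⟩

lemma IsRegularLevel.lowerPoint_le {u : ℝ} (hu : IsRegularLevel μ ν u) :
    lowerPoint μ ν u ≤ G μ u := by
  rcases hu.cases hμ hν hcx with ⟨-, h⟩ | ⟨-, h, -⟩
  · exact h.le
  · exact h.le

lemma IsRegularLevel.contact_lowerPoint {u : ℝ} (hu : IsRegularLevel μ ν u) :
    hull (E μ ν u) (lowerPoint μ ν u) = E μ ν u (lowerPoint μ ν u) := by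
  rcases hu.cases hμ hν hcx with ⟨h, h'⟩ | ⟨-, -, -, h, -⟩
  · rw [h', ← h]; exact (S_mem hμ hν hcx hu.1).2
  · exact h

lemma lowerMass_mul {u : ℝ} (hu : IsRegularLevel μ ν u) :
    lowerMass μ ν u * (S μ ν u - lowerPoint μ ν u) = S μ ν u - G μ u := by
  rcases hu.cases hμ hν hcx with ⟨h, h'⟩ | ⟨-, h1, h2, -⟩
  · rw [h', h]; simp
  · exact div_mul_cancel₀ _ (by linarith)

lemma lowerMass_mem {u : ℝ} (hu : IsRegularLevel μ ν u) : lowerMass μ ν u ∈ Icc (0 : ℝ) 1 := by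
  have h1 := (S_mem hμ hν hcx hu.1).1
  have h2 := hu.lowerPoint_le hμ hν hcx
  exact ⟨div_nonneg (by linarith) (by linarith), div_le_one_of_le₀ (by linarith) (by linarith)⟩

omit hν hcx [IsProbabilityMeasure ν] in
lemma hasDerivAt_E {u : ℝ} (hu : u ∈ Ioo (0 : ℝ) 1) (hc : ContinuousAt (G μ) u) (k : ℝ) :
    HasDerivAt (fun v => E μ ν v k) (-max (k - G μ u) 0) u :=
  (hasDerivAt_P_lower hμ hu hc k).const_sub _

lemma hull_E_antitoneOn (y : ℝ) :
    AntitoneOn (fun u => hull (E μ ν u) y) (Ioo (0 : ℝ) 1) := fun _ hu _ hv huv =>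
  le_hull (convexOn_hull (E_nonneg hμ hν hcx hv))
    (fun x => (hull_le (E_nonneg hμ hν hcx hv) x).trans (E_antitone hμ hu hv huv x)) y

/-- Up to `b` the functions `E u` and `E v` differ by at most the added term, and to the left of the
contact point `b` the hull does not see what happens beyond `b`. -/
lemma hull_E_sub_le {u v : ℝ} (hu : u ∈ Ioo (0 : ℝ) 1) (hv : v ∈ Ioo (0 : ℝ) 1) (huv : u ≤ v)
    {b y : ℝ} (hyb : y ≤ b) (hb : hull (E μ ν v) b = E μ ν v b) :
    hull (E μ ν u) y ≤ hull (E μ ν v) y + (v - u) * max (b - G μ u) 0 := by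
  refine hull_le_hull_add (E_nonneg hμ hν hcx hu) (E_nonneg hμ hν hcx hv) hyb hb fun x hx => ?_
  have h1 := P_lower_sub_le hμ hu hv huv x
  have h2 : (v - u) * max (x - G μ u) 0 ≤ (v - u) * max (b - G μ u) 0 :=
    mul_le_mul_of_nonneg_left (max_le_max_right 0 (by linarith)) (by linarith)
  simp only [E]
  linarith

/-- The envelope theorem for the hull. -/
lemma eq_neg_levelPotential {u y d : ℝ} (hu : IsRegularLevel μ ν u)
    (hd : HasDerivAt (fun v => hull (E μ ν v) y) d u) : d = -levelPotential μ ν y u := by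
  have hn : ∀ᶠ v in 𝓝 u, v ∈ Ioo (0 : ℝ) 1 := Ioo_mem_nhds hu.1.1 hu.1.2
  have hGS := (S_mem hμ hν hcx hu.1).1
  have hRG := hu.lowerPoint_le hμ hν hcx
  have hmul := lowerMass_mul hμ hν hcx hu
  unfold levelPotential
  rcases le_or_gt (S μ ν u) y with hy | hy
  -- The hull is below `E v` at `y` for all levels `v`, with equality at `v = u`, so the two
  -- derivatives in the level coincide.
  · have hmax : IsLocalMax (fun v => hull (E μ ν v) y - E μ ν v y) u := by
      filter_upwards [hn] with v hv
      rw [contact_of_S_le hμ hν hcx hu.1 hy, sub_self]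
      exact sub_nonpos.2 (hull_le (E_nonneg hμ hν hcx hv) y)
    have h := hmax.hasDerivAt_eq_zero (hd.sub (hasDerivAt_E hμ hu.1 hu.2.2 y))
    rw [max_eq_left (by linarith)] at h
    rw [max_eq_left (by linarith), max_eq_left (by linarith)]
    linarith
  rw [max_eq_right (by linarith : y - S μ ν u ≤ 0), mul_zero, add_zero]
  rcases le_or_gt (lowerPoint μ ν u) y with hy' | hy'
  · rcases hu.cases hμ hν hcx with ⟨h, h'⟩ | ⟨-, h1, h2, h3, θ, h4⟩
    · linarith
    have hpos : 0 < S μ ν u - lowerPoint μ ν u := by linarith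
    set s := S μ ν u with hs
    set r := lowerPoint μ ν u with hr
    have hab : (s - y) / (s - r) + (y - r) / (s - r) = 1 := by field_simp; ring
    have hcomb : (s - y) / (s - r) * r + (y - r) / (s - r) * s = y := by field_simp; ring
    have ha : 0 ≤ (s - y) / (s - r) := div_nonneg (by linarith) hpos.le
    have hb : 0 ≤ (y - r) / (s - r) := div_nonneg (by linarith) hpos.le
    set a := (s - y) / (s - r)
    set b := (y - r) / (s - r) with hbdef
    -- By convexity the hull at `y` is at most the chord of `E v` over the fixed points `r`, `s`; at
    -- `v = u` there is equality, since the hull is affine on `[r, s]` with contact at both ends.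
    have hmax : IsLocalMax
        (fun v => hull (E μ ν v) y - (a * E μ ν v r + b * E μ ν v s)) u := by
      have h0 : hull (E μ ν u) y - (a * E μ ν u r + b * E μ ν u s) = 0 := by
        rw [← h3, ← contact_of_S_le hμ hν hcx hu.1 hs.le, h4 y ⟨hy', hy.le⟩,
          h4 r ⟨le_rfl, by linarith⟩, h4 s ⟨by linarith, le_rfl⟩]
        have hb' : b = 1 - a := by linarith
        rw [hb'] at hcomb ⊢
        linear_combination (-θ) * hcomb
      filter_upwards [hn] with v hv
      rw [h0]
      have hnv := E_nonneg hμ hν hcx hv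
      have h5 := (convexOn_hull hnv).2 (mem_univ r) (mem_univ s) ha hb hab
      simp only [smul_eq_mul, hcomb] at h5
      have h6 := mul_le_mul_of_nonneg_left (hull_le hnv r) ha
      have h7 := mul_le_mul_of_nonneg_left (hull_le hnv s) hb
      linarith
    have h := hmax.hasDerivAt_eq_zero (hd.sub
      (((hasDerivAt_E hμ hu.1 hu.2.2 r).const_mul a).add
        ((hasDerivAt_E hμ hu.1 hu.2.2 s).const_mul b)))
    rw [max_eq_right (by linarith), max_eq_left (by linarith)] at h
    rw [max_eq_left (by linarith)]
    have h8 : b * (s - G μ u) = lowerMass μ ν u * (y - r) := by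
      rw [hbdef, lowerMass, ← hs, ← hr]; ring
    linarith
  · rw [max_eq_right (by linarith), mul_zero, neg_zero]
    -- Here `y` is to the left of the contact point `lowerPoint u ≤ G u`, so for `v < u` the hull
    -- changes by at most `(u - v) * (G u - G v)`. Continuity of `G` makes the left difference
    -- quotient vanish, which suffices as the derivative exists.
    have h1 := (hasDerivWithinAt_iff_tendsto_slope' self_notMem_Iio).1
      (hd.hasDerivWithinAt (s := Iio u))
    have h2 : Tendsto (fun v => -(G μ u - G μ v)) (𝓝[<] u) (𝓝 0) := by
      have := ((tendsto_const_nhds (x := G μ u)).sub hu.2.2.tendsto).neg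
      rw [sub_self, neg_zero] at this
      exact this.mono_left nhdsWithin_le_nhds
    refine tendsto_nhds_unique h1 (tendsto_of_tendsto_of_tendsto_of_le_of_le' h2
      tendsto_const_nhds ?_ ?_)
    · filter_upwards [self_mem_nhdsWithin, nhdsWithin_le_nhds hn] with v hvu hv
      have hvu : v < u := hvu
      rw [slope_comm, slope_def_field, le_div_iff₀ (by linarith)]
      have h3 := hull_E_sub_le hμ hν hcx hv hu.1 hvu.le hy'.le (hu.contact_lowerPoint hμ hν hcx)
      have h4 := G_monotoneOn (μ := μ) hv hu.1 hvu.le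
      have h5 : max (lowerPoint μ ν u - G μ v) 0 ≤ G μ u - G μ v :=
        max_le (by linarith) (by linarith)
      nlinarith
    · filter_upwards [self_mem_nhdsWithin, nhdsWithin_le_nhds hn] with v hvu hv
      have hvu : v < u := hvu
      rw [slope_comm, slope_def_field]
      refine div_nonpos_of_nonpos_of_nonneg ?_ (by linarith)
      exact sub_nonpos.2 (hull_E_antitoneOn hμ hν hcx y hv hu.1 hvu.le)

/-- Provides the absolute continuity needed for the fundamental theorem of calculus. The levels stay
away from `0` and `1`, where `G` and `S` may be unbounded; the contact point is `max y (S v)`. -/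
lemma lipschitzOnWith_hull_E {a b : ℝ} (ha : 0 < a) (hb : b < 1) (hab : a ≤ b) (y : ℝ) :
    LipschitzOnWith (Real.toNNReal (max (max y (S μ ν b) - G μ a) 0))
      (fun u => hull (E μ ν u) y) (Icc a b) := by
  have hsub : ∀ u ∈ Icc a b, u ∈ Ioo (0 : ℝ) 1 := fun u hu =>
    ⟨ha.trans_le hu.1, hu.2.trans_lt hb⟩
  have key : ∀ u ∈ Icc a b, ∀ v ∈ Icc a b, u ≤ v →
      |hull (E μ ν u) y - hull (E μ ν v) y| ≤ max (max y (S μ ν b) - G μ a) 0 * |u - v| := by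
    intro u hu v hv huv
    have hu' := hsub u hu
    have hv' := hsub v hv
    have h1 := hull_E_antitoneOn hμ hν hcx y hu' hv' huv
    have h2 := hull_E_sub_le hμ hν hcx hu' hv' huv (le_max_left y (S μ ν v))
      (contact_of_S_le hμ hν hcx hv' (le_max_right _ _))
    have h3 : max (max y (S μ ν v) - G μ u) 0 ≤ max (max y (S μ ν b) - G μ a) 0 := by
      refine max_le_max_right 0 (sub_le_sub (max_le_max_left y ?_) ?_)
      · exact S_monotoneOn hμ hν hcx hv' (hsub b ⟨hab, le_rfl⟩) hv.2
      · exact G_monotoneOn (hsub a ⟨le_rfl, hab⟩) hu' hu.1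
    simp only at h1
    rw [abs_of_nonneg (by linarith), abs_of_nonpos (by linarith)]
    nlinarith [sub_nonneg.2 huv]
  refine LipschitzOnWith.of_dist_le_mul fun u hu v hv => ?_
  rw [Real.coe_toNNReal _ (le_max_right _ _), Real.dist_eq, Real.dist_eq]
  rcases le_total u v with h | h
  · exact key u hu v hv h
  · rw [abs_sub_comm, abs_sub_comm u v]
    exact key v hv u hu h

/-- The hull at `y` is monotone in the level, hence differentiable almost everywhere, and the
envelope theorem identifies the derivative. -/
lemma ae_levelPotential_eq (hD : {k : ℝ | 0 < D μ ν k}.OrdConnected) (y : ℝ) :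
    ∀ᵐ u ∂(volume.restrict (Ioo (0 : ℝ) 1)),
      levelPotential μ ν y u = -deriv (fun v => hull (E μ ν v) y) u := by
  have hmono : MonotoneOn (fun v => -hull (E μ ν v) y) (Ioo (0 : ℝ) 1) :=
    (hull_E_antitoneOn hμ hν hcx y).neg
  have h1 := hmono.ae_differentiableWithinAt measurableSet_Ioo
  filter_upwards [h1, ae_isRegularLevel hμ hν hcx hD] with u hu hreg
  have hd : DifferentiableAt ℝ (fun v => hull (E μ ν v) y) u := by
    have := (hu.differentiableAt (Ioo_mem_nhds hreg.1.1 hreg.1.2)).neg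
    simpa [Pi.neg_def] using this
  rw [eq_neg_levelPotential hμ hν hcx hreg hd.hasDerivAt, neg_neg]

lemma lintegral_levelPotential_Ioc (hD : {k : ℝ | 0 < D μ ν k}.OrdConnected) (y : ℝ) {a b : ℝ}
    (ha : 0 < a) (hb : b < 1) (hab : a ≤ b) :
    ∫⁻ u in Ioc a b, ENNReal.ofReal (levelPotential μ ν y u) =
      ENNReal.ofReal (hull (E μ ν a) y - hull (E μ ν b) y) := by
  have hac : AbsolutelyContinuousOnInterval (fun u => hull (E μ ν u) y) a b := by
    refine LipschitzOnWith.absolutelyContinuousOnInterval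
      (K := Real.toNNReal (max (max y (S μ ν b) - G μ a) 0)) ?_
    rw [uIcc_of_le hab]
    exact lipschitzOnWith_hull_E hμ hν hcx ha hb hab y
  have hint := hac.intervalIntegrable_deriv
  have hsub : Ioc a b ⊆ Ioo (0 : ℝ) 1 := fun u hu => ⟨ha.trans hu.1, hu.2.trans_lt hb⟩
  have hae := ae_restrict_of_ae_restrict_of_subset hsub (ae_levelPotential_eq hμ hν hcx hD y)
  have hreg := ae_restrict_of_ae_restrict_of_subset hsub (ae_isRegularLevel hμ hν hcx hD)
  have hI : IntegrableOn (fun u => -deriv (fun v => hull (E μ ν v) y) u) (Ioc a b) :=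
    ((intervalIntegrable_iff_integrableOn_Ioc_of_le hab).1 hint).neg
  have hI' : IntegrableOn (levelPotential μ ν y) (Ioc a b) := hI.congr (hae.mono fun _ h => h.symm)
  rw [← ofReal_integral_eq_lintegral_ofReal hI', integral_congr_ae hae, integral_neg,
    ← intervalIntegral.integral_of_le hab, hac.integral_deriv_eq_sub]
  · congr 1; ring
  · filter_upwards [hreg] with u hu
    have := lowerMass_mem hμ hν hcx hu
    exact add_nonneg (mul_nonneg this.1 (le_max_right _ _))
      (mul_nonneg (by linarith [this.2]) (le_max_right _ _))

/-- A supporting line of negative slope at `y`, compared with `D → 0` at `-∞`, forces the hull to be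
at most `0` at `y`, while it is nonnegative everywhere. -/
lemma hull_E_mono {u : ℝ} (hu : u ∈ Ioo (0 : ℝ) 1) : Monotone (hull (E μ ν u)) := by
  intro y b hyb
  have hn := E_nonneg hμ hν hcx hu
  obtain ⟨θ, hθ⟩ := exists_subgradient (convexOn_hull hn) y
  rcases le_or_gt 0 θ with h | h
  · nlinarith [hθ b]
  · refine le_trans ?_ (hull_nonneg hn b)
    refine ge_of_tendsto (tendsto_D_atBot hμ hν) ?_
    filter_upwards [eventually_le_atBot (min y (G μ u))] with k hk
    have h1 := (hθ k).trans (hull_le hn k)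
    rw [E_eq_D hμ hu (hk.trans (min_le_right _ _))] at h1
    nlinarith [hk.trans (min_le_left _ _)]

lemma tendsto_hull_E_zero (y : ℝ) :
    Tendsto (fun u => hull (E μ ν u) y) (𝓝[>] 0) (𝓝 (P ν y)) := by
  have hmem : ∀ᶠ u in 𝓝[>] (0 : ℝ), u ∈ Ioo (0 : ℝ) 1 := Ioo_mem_nhdsGT one_pos
  set m := ∫ x, x ∂ν with hm
  -- The convex minorant `(1 - u) * P ν` minus a constant comes from `P_lower_le_P_add` at `l =
  -- -(√u)⁻¹`, with `k` bounded by `P ν k` plus the mean. This choice has `l → -∞` and still `u *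
  -- |l| = √u → 0`.
  have hlow : ∀ᶠ u in 𝓝[>] (0 : ℝ),
      (1 - u) * P ν y - (P μ (-(√u)⁻¹) + (u * |m| + √u)) ≤ hull (E μ ν u) y := by
    filter_upwards [hmem] with u hu
    have hconv : ConvexOn ℝ univ fun k => (1 - u) * P ν k +
        -(P μ (-(√u)⁻¹) + (u * |m| + √u)) :=
      ((convexOn_P (integrable_max hν)).smul (by linarith [hu.2] : (0 : ℝ) ≤ 1 - u)).add
        (convexOn_const _ convex_univ)
    have := le_hull (f := E μ ν u) hconv (fun k => ?_) y
    · linarith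
    have h1 := P_lower_le_P_add hμ hu k (-(√u)⁻¹)
    have h2 := sub_mean_le_P hν k
    have hs : 0 < √u := Real.sqrt_pos.2 hu.1
    have h3 : max (k - -(√u)⁻¹) 0 ≤ P ν k + |m| + (√u)⁻¹ := by
      have h4 := inv_pos.2 hs
      have h5 := P_nonneg ν k
      refine max_le ?_ (by positivity)
      linarith [le_abs_self m]
    have h6 : u * (√u)⁻¹ = √u := by
      rw [← div_eq_mul_inv, Real.div_sqrt]
    have h7 := mul_le_mul_of_nonneg_left h3 hu.1.le
    simp only [E]
    nlinarith
  have hid : Tendsto (fun u : ℝ => u) (𝓝[>] 0) (𝓝 0) := nhdsWithin_le_nhds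
  have hsq : Tendsto (fun u : ℝ => √u) (𝓝[>] 0) (𝓝 0) := by
    simpa using hid.sqrt
  have hsq' : Tendsto (fun u : ℝ => √u) (𝓝[>] 0) (𝓝[>] 0) := by
    refine tendsto_nhdsWithin_iff.2 ⟨hsq, ?_⟩
    filter_upwards [self_mem_nhdsWithin] with u hu using Real.sqrt_pos.2 hu
  have hP : Tendsto (fun u : ℝ => P μ (-(√u)⁻¹)) (𝓝[>] 0) (𝓝 0) :=
    (tendsto_P_atBot hμ).comp
      (tendsto_neg_atTop_atBot.comp (tendsto_inv_nhdsGT_zero.comp hsq'))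
  have hl : Tendsto (fun u : ℝ => (1 - u) * P ν y - (P μ (-(√u)⁻¹) + (u * |m| + √u))) (𝓝[>] 0)
      (𝓝 ((1 - 0) * P ν y - (0 + (0 * |m| + 0)))) :=
    ((tendsto_const_nhds.sub hid).mul_const _).sub (hP.add ((hid.mul_const _).add hsq))
  have he : (1 - 0) * P ν y - (0 + (0 * |m| + 0)) = P ν y := by ring
  rw [he] at hl
  refine tendsto_of_tendsto_of_tendsto_of_le_of_le' hl tendsto_const_nhds hlow ?_
  filter_upwards [hmem] with u hu
  refine (hull_le (E_nonneg hμ hν hcx hu) y).trans ?_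
  have : 0 ≤ P (lower μ u) y := P_nonneg _ _
  simp only [E]; linarith

lemma tendsto_hull_E_one (y : ℝ) :
    Tendsto (fun u => hull (E μ ν u) y) (𝓝[<] 1) (𝓝 0) := by
  have hmem : ∀ᶠ u in 𝓝[<] (1 : ℝ), u ∈ Ioo (1 / 2 : ℝ) 1 := Ioo_mem_nhdsLT (by norm_num)
  set c := |y| + |G μ (1 / 2)| with hc
  -- Monotonicity moves `y` to a point tending to `∞`, where `D` is small. The rate `(√(1 - u))⁻¹`
  -- keeps the omitted mass `1 - u` times the distance negligible; `c` bounds `y - G u` because `u >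
  -- 1 / 2`.
  have hup : ∀ᶠ u in 𝓝[<] (1 : ℝ), hull (E μ ν u) y ≤
      D μ ν (y + (√(1 - u))⁻¹) + ((1 - u) * c + √(1 - u)) := by
    filter_upwards [hmem] with u hu
    have hu' : u ∈ Ioo (0 : ℝ) 1 := ⟨by linarith [hu.1], hu.2⟩
    have hs : 0 < √(1 - u) := Real.sqrt_pos.2 (by linarith [hu.2])
    have hi := inv_pos.2 hs
    have h1 := hull_E_mono hμ hν hcx hu' (by linarith : y ≤ y + (√(1 - u))⁻¹)
    have h2 := hull_le (E_nonneg hμ hν hcx hu') (y + (√(1 - u))⁻¹)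
    have h3 := P_sub_P_lower_le hμ hu' (y + (√(1 - u))⁻¹)
    have h4 : max (y + (√(1 - u))⁻¹ - G μ u) 0 ≤ c + (√(1 - u))⁻¹ := by
      have := G_monotoneOn (μ := μ) (by norm_num : (1 / 2 : ℝ) ∈ Ioo (0 : ℝ) 1) hu' hu.1.le
      refine max_le ?_ (by positivity)
      linarith [le_abs_self y, neg_abs_le (G μ (1 / 2))]
    have h5 : (1 - u) * (√(1 - u))⁻¹ = √(1 - u) := by
      rw [← div_eq_mul_inv, Real.div_sqrt]
    have h6 := mul_le_mul_of_nonneg_left h4 (by linarith [hu.2] : 0 ≤ 1 - u)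
    simp only [E, D] at *
    linarith
  have hid : Tendsto (fun u : ℝ => 1 - u) (𝓝[<] 1) (𝓝 0) := by
    have : Tendsto (fun u : ℝ => 1 - u) (𝓝 1) (𝓝 (1 - 1)) := tendsto_const_nhds.sub tendsto_id
    rw [sub_self] at this
    exact this.mono_left nhdsWithin_le_nhds
  have hsq : Tendsto (fun u : ℝ => √(1 - u)) (𝓝[<] 1) (𝓝 0) := by
    simpa using hid.sqrt
  have hsq' : Tendsto (fun u : ℝ => √(1 - u)) (𝓝[<] 1) (𝓝[>] 0) := by
    refine tendsto_nhdsWithin_iff.2 ⟨hsq, ?_⟩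
    filter_upwards [self_mem_nhdsWithin] with u hu
    exact Real.sqrt_pos.2 (sub_pos.2 hu)
  have hP : Tendsto (fun u : ℝ => D μ ν (y + (√(1 - u))⁻¹)) (𝓝[<] 1) (𝓝 0) :=
    (hcx.tendsto_D_atTop hμ hν).comp
      (tendsto_atTop_add_const_left _ y (tendsto_inv_nhdsGT_zero.comp hsq'))
  have hl := hP.add ((hid.mul_const c).add hsq)
  rw [zero_mul, add_zero, add_zero] at hl
  refine tendsto_of_tendsto_of_tendsto_of_le_of_le' tendsto_const_nhds hl ?_ hup
  filter_upwards [hmem] with u hu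
  exact hull_nonneg (E_nonneg hμ hν hcx ⟨by linarith [hu.1], hu.2⟩) y

lemma aemeasurable_levelPotential (hD : {k : ℝ | 0 < D μ ν k}.OrdConnected) (y : ℝ) :
    AEMeasurable (levelPotential μ ν y) (volume.restrict (Ioo (0 : ℝ) 1)) :=
  ⟨_, (measurable_deriv _).neg, ae_levelPotential_eq hμ hν hcx hD y⟩

/-- The potentials at the levels integrate to the potential of `ν`. -/
lemma lintegral_levelPotential (hD : {k : ℝ | 0 < D μ ν k}.OrdConnected) (y : ℝ) :
    ∫⁻ u in Ioo (0 : ℝ) 1, ENNReal.ofReal (levelPotential μ ν y u) = ENNReal.ofReal (P ν y) := by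
  obtain ⟨a, ha, ha0, hal⟩ := exists_seq_strictAnti_tendsto' (show (0 : ℝ) < 1 / 2 by norm_num)
  obtain ⟨b, hb, hb0, hbl⟩ := exists_seq_strictMono_tendsto' (show (1 / 2 : ℝ) < 1 by norm_num)
  have hcover := aecover_Ioo_of_Ioc (μ := volume) hal hbl
  refine hcover.lintegral_eq_of_tendsto _
    (aemeasurable_levelPotential hμ hν hcx hD y).ennreal_ofReal ?_
  have h0 := (tendsto_hull_E_zero hμ hν hcx y).comp
    (tendsto_nhdsWithin_iff.2 ⟨hal, .of_forall fun n => (ha0 n).1⟩)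
  have h1 := (tendsto_hull_E_one hμ hν hcx y).comp
    (tendsto_nhdsWithin_iff.2 ⟨hbl, .of_forall fun n => (hb0 n).2⟩)
  have h2 := ENNReal.tendsto_ofReal (h0.sub h1)
  rw [sub_zero] at h2
  refine h2.congr fun n => ?_
  have hsub : Ioc (a n) (b n) ⊆ Ioo (0 : ℝ) 1 := fun u hu =>
    ⟨(ha0 n).1.trans hu.1, hu.2.trans_lt (hb0 n).2⟩
  rw [Measure.restrict_restrict_of_subset hsub, lintegral_levelPotential_Ioc hμ hν hcx hD y
    (ha0 n).1 (hb0 n).2 ((ha0 n).2.trans (hb0 n).1).le]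
  rfl

end Level

/-- The two-valued random variable with values `lowerPoint` and `S`, which agrees with `Y` almost
everywhere. -/
noncomputable def twoPoint (μ ν : Measure ℝ) (ω : ℝ × ℝ) : ℝ :=
  if ω.2 ≤ lowerMass μ ν ω.1 then lowerPoint μ ν ω.1 else S μ ν ω.1

lemma unif_eq_prod :
    unif = (volume.restrict (Ioo (0 : ℝ) 1)).prod (volume.restrict (Ioo (0 : ℝ) 1)) := by
  rw [unif, Measure.prod_restrict, Measure.volume_eq_prod]

lemma restrict_Ioo_eq_Ioc :
    (volume : Measure ℝ).restrict (Ioo 0 1) = volume.restrict (Ioc 0 1) :=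
  Measure.restrict_congr_set Ioo_ae_eq_Ioc

lemma lintegral_ite_le {p : ℝ} (hp : p ∈ Icc (0 : ℝ) 1) (a b : ENNReal) :
    ∫⁻ v in Ioo (0 : ℝ) 1, (if v ≤ p then a else b) =
      ENNReal.ofReal p * a + ENNReal.ofReal (1 - p) * b := by
  have h1 : Iic p ∩ Ioc 0 1 = Ioc 0 p := by
    ext v
    simp only [mem_inter_iff, mem_Iic, mem_Ioc]
    exact ⟨fun h => ⟨h.2.1, h.1⟩, fun h => ⟨h.2, h.1, h.2.trans hp.2⟩⟩
  have h2 : (Iic p)ᶜ ∩ Ioc 0 1 = Ioc p 1 := by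
    ext v
    simp only [mem_inter_iff, mem_compl_iff, mem_Iic, mem_Ioc, not_le]
    exact ⟨fun h => ⟨h.1, h.2.2⟩, fun h => ⟨h.1, hp.1.trans_lt h.1, h.2⟩⟩
  have h3 : ∀ v ∈ Iic p, (if v ≤ p then a else b) = a := fun v hv => if_pos hv
  have h4 : ∀ v ∈ (Iic p)ᶜ, (if v ≤ p then a else b) = b := fun v hv => if_neg hv
  rw [restrict_Ioo_eq_Ioc, ← lintegral_add_compl _ (measurableSet_Iic (a := p)),
    setLIntegral_congr_fun measurableSet_Iic h3, setLIntegral_congr_fun measurableSet_Iic.compl h4,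
    setLIntegral_const, setLIntegral_const, Measure.restrict_apply measurableSet_Iic,
    Measure.restrict_apply measurableSet_Iic.compl, h1, h2, Real.volume_Ioc, Real.volume_Ioc,
    sub_zero, mul_comm, mul_comm b]

/-! ### The law of `Y` -/

section Law

variable {μ ν : Measure ℝ} [IsProbabilityMeasure μ] [IsProbabilityMeasure ν]
  (hμ : Integrable (fun x : ℝ => x) μ) (hν : Integrable (fun x : ℝ => x) ν)
  (hcx : ConvexOrder μ ν)
include hμ hν hcx

/-- If `S u = G u` the numerator is zero whatever `R u` is; otherwise `R u` is real and the extended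
quotient is the real one. -/
lemma IsRegularLevel.weight_eq {u : ℝ} (hu : IsRegularLevel μ ν u) :
    weight μ ν u = lowerMass μ ν u := by
  rcases hu.cases hμ hν hcx with ⟨h, h'⟩ | ⟨h1, -⟩
  · rw [weight, lowerMass, h, h', sub_self]; simp
  · rw [weight, lowerMass, h1, ← EReal.coe_sub, ← EReal.coe_div, EReal.toReal_coe]

lemma IsRegularLevel.Y_eq {u v : ℝ} (hu : IsRegularLevel μ ν u) (hv : 0 < v) :
    Y μ ν (u, v) = twoPoint μ ν (u, v) := by
  rw [Y, twoPoint, hu.weight_eq hμ hν hcx]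
  simp only
  rcases hu.cases hμ hν hcx with ⟨h, h'⟩ | ⟨h1, h2, h3, -⟩
  · have h0 : lowerMass μ ν u = 0 := by rw [lowerMass, h, h', sub_self, zero_div]
    rw [h0, h, h']
    simp [not_le.2 hv]
  · rw [h1, if_neg (fun h => by rw [EReal.coe_eq_coe_iff] at h; linarith), EReal.toReal_coe]

/-- A potential is positive exactly to the right of the lowest atom. This transfers measurability to
`lowerPoint` from `levelPotential`, which is almost everywhere minus a derivative. -/
lemma IsRegularLevel.lowerPoint_lt_iff {u : ℝ} (hu : IsRegularLevel μ ν u) (c : ℝ) :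
    lowerPoint μ ν u < c ↔ 0 < levelPotential μ ν c u := by
  have hp := lowerMass_mem hμ hν hcx hu
  have hRG := hu.lowerPoint_le hμ hν hcx
  have hGS := (S_mem hμ hν hcx hu.1).1
  have hn : 0 ≤ (1 - lowerMass μ ν u) * max (c - S μ ν u) 0 :=
    mul_nonneg (by linarith [hp.2]) (le_max_right _ _)
  constructor
  · intro h
    rcases hu.cases hμ hν hcx with ⟨h', h''⟩ | ⟨-, h2, h3, -⟩
    · have h0 : lowerMass μ ν u = 0 := by rw [lowerMass, h', h'', sub_self, zero_div]
      rw [levelPotential, h0, h', zero_mul, zero_add, sub_zero, one_mul]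
      exact lt_max_of_lt_left (by linarith)
    · have h4 : 0 < lowerMass μ ν u := div_pos (by linarith) (by linarith)
      exact add_pos_of_pos_of_nonneg (mul_pos h4 (lt_max_of_lt_left (by linarith))) hn
  · intro h
    by_contra hc
    rw [levelPotential, max_eq_right (by linarith), max_eq_right (by linarith)] at h
    simp at h

variable (hD : {k : ℝ | 0 < D μ ν k}.OrdConnected)

omit hμ hν hcx [IsProbabilityMeasure ν] in
lemma aemeasurable_G : AEMeasurable (G μ) (volume.restrict (Ioo (0 : ℝ) 1)) :=
  aemeasurable_restrict_of_monotoneOn measurableSet_Ioo G_monotoneOn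

lemma aemeasurable_S : AEMeasurable (S μ ν) (volume.restrict (Ioo (0 : ℝ) 1)) :=
  aemeasurable_restrict_of_monotoneOn measurableSet_Ioo (S_monotoneOn hμ hν hcx)

include hD

lemma aemeasurable_lowerPoint :
    AEMeasurable (lowerPoint μ ν) (volume.restrict (Ioo (0 : ℝ) 1)) := by
  have : NullMeasurable (lowerPoint μ ν) (volume.restrict (Ioo (0 : ℝ) 1)) := by
    refine measurable_of_Iio
      (δ := NullMeasurableSpace ℝ (volume.restrict (Ioo (0 : ℝ) 1))) (f := lowerPoint μ ν)
      fun c => ?_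
    have h1 : NullMeasurableSet {u | 0 < levelPotential μ ν c u}
        (volume.restrict (Ioo (0 : ℝ) 1)) :=
      (aemeasurable_levelPotential hμ hν hcx hD c).nullMeasurable measurableSet_Ioi
    refine h1.congr ?_
    filter_upwards [ae_isRegularLevel hμ hν hcx hD] with u hu
    exact propext (hu.lowerPoint_lt_iff hμ hν hcx c).symm
  exact this.aemeasurable

lemma aemeasurable_lowerMass :
    AEMeasurable (lowerMass μ ν) (volume.restrict (Ioo (0 : ℝ) 1)) :=
  ((aemeasurable_S hμ hν hcx).sub aemeasurable_G).div
    ((aemeasurable_S hμ hν hcx).sub (aemeasurable_lowerPoint hμ hν hcx hD))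

lemma aemeasurable_twoPoint : AEMeasurable (twoPoint μ ν) unif := by
  rw [unif_eq_prod]
  obtain ⟨p, hp, hp'⟩ := aemeasurable_lowerMass hμ hν hcx hD
  obtain ⟨r, hr, hr'⟩ := aemeasurable_lowerPoint hμ hν hcx hD
  obtain ⟨s, hs, hs'⟩ := aemeasurable_S hμ hν hcx
  refine ⟨fun ω => if ω.2 ≤ p ω.1 then r ω.1 else s ω.1,
    Measurable.ite (measurableSet_le measurable_snd (hp.comp measurable_fst))
      (hr.comp measurable_fst) (hs.comp measurable_fst), ?_⟩
  filter_upwards [Measure.quasiMeasurePreserving_fst.ae hp',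
    Measure.quasiMeasurePreserving_fst.ae hr',
    Measure.quasiMeasurePreserving_fst.ae hs'] with ω h1 h2 h3
  rw [twoPoint, h1, h2, h3]

lemma Y_ae_eq : Y μ ν =ᵐ[unif] twoPoint μ ν := by
  rw [unif_eq_prod]
  filter_upwards [Measure.quasiMeasurePreserving_fst.ae (ae_isRegularLevel hμ hν hcx hD),
    Measure.quasiMeasurePreserving_snd.ae
      (ae_restrict_mem (μ := (volume : Measure ℝ)) (measurableSet_Ioo (a := 0) (b := 1)))]
    with ω h1 h2
  exact h1.Y_eq hμ hν hcx h2.1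

lemma aemeasurable_Y : AEMeasurable (Y μ ν) unif :=
  (aemeasurable_twoPoint hμ hν hcx hD).congr (Y_ae_eq hμ hν hcx hD).symm

lemma lintegral_law {f : ℝ → ENNReal} (hf : Measurable f) :
    ∫⁻ x, f x ∂(law μ ν) = ∫⁻ u in Ioo (0 : ℝ) 1,
      (ENNReal.ofReal (lowerMass μ ν u) * f (lowerPoint μ ν u) +
        ENNReal.ofReal (1 - lowerMass μ ν u) * f (S μ ν u)) := by
  have hm : AEMeasurable (fun ω => f (twoPoint μ ν ω)) unif :=
    hf.comp_aemeasurable (aemeasurable_twoPoint hμ hν hcx hD)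
  rw [law, lintegral_map' hf.aemeasurable (aemeasurable_Y hμ hν hcx hD),
    lintegral_congr_ae ((Y_ae_eq hμ hν hcx hD).mono fun ω h => congrArg f h)]
  rw [unif_eq_prod] at hm ⊢
  rw [lintegral_prod _ hm]
  refine lintegral_congr_ae ?_
  filter_upwards [ae_isRegularLevel hμ hν hcx hD] with u hu
  rw [← lintegral_ite_le (lowerMass_mem hμ hν hcx hu)]
  refine lintegral_congr fun v => ?_
  rw [twoPoint]
  split_ifs <;> rfl

lemma lintegral_law_max (k : ℝ) :
    ∫⁻ x, ENNReal.ofReal (max (k - x) 0) ∂(law μ ν) = ENNReal.ofReal (P ν k) := by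
  rw [lintegral_law hμ hν hcx hD (f := fun x => ENNReal.ofReal (max (k - x) 0))
    (by fun_prop), ← lintegral_levelPotential hμ hν hcx hD k]
  refine lintegral_congr_ae ?_
  filter_upwards [ae_isRegularLevel hμ hν hcx hD] with u hu
  have hp := lowerMass_mem hμ hν hcx hu
  have hq : 0 ≤ 1 - lowerMass μ ν u := by linarith [hp.2]
  rw [levelPotential, ENNReal.ofReal_add (mul_nonneg hp.1 (le_max_right _ _))
    (mul_nonneg hq (le_max_right _ _)), ENNReal.ofReal_mul hp.1, ENNReal.ofReal_mul hq]

/-- A first moment of the law is not known at this stage; this is why the basic lemmas on potentials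
assume only integrability of `(k - x)⁺`. -/
lemma integrable_max_law (k : ℝ) : Integrable (fun x => max (k - x) 0) (law μ ν) := by
  refine ⟨by fun_prop, ?_⟩
  rw [hasFiniteIntegral_iff_ofReal (.of_forall fun x => le_max_right (k - x) 0),
    lintegral_law_max hμ hν hcx hD]
  exact ENNReal.ofReal_lt_top

lemma P_law (k : ℝ) : P (law μ ν) k = P ν k := by
  rw [P, integral_eq_lintegral_of_nonneg_ae (.of_forall fun x => le_max_right (k - x) 0) (by fun_prop),
    lintegral_law_max hμ hν hcx hD, ENNReal.toReal_ofReal (P_nonneg ν k)]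

omit hμ hν hcx hD [IsProbabilityMeasure μ] [IsProbabilityMeasure ν] in
instance isFiniteMeasure_law : IsFiniteMeasure (law μ ν) := by
  have : IsFiniteMeasure unif := by rw [unif_eq_prod]; infer_instance
  rw [law]; infer_instance

/-- The law of `Y` and `ν` have the same distribution function. -/
lemma law_Iic (y : ℝ) : law μ ν (Iic y) = ν (Iic y) := by
  have h1 := hasDerivWithinAt_P (integrable_max_law hμ hν hcx hD) y
  have h2 := hasDerivWithinAt_P (integrable_max hν) y
  rw [funext (P_law hμ hν hcx hD)] at h1
  have := (uniqueDiffWithinAt_Ioi y).eq_deriv _ h1 h2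
  exact (ENNReal.toReal_eq_toReal_iff' (measure_ne_top _ _) (measure_ne_top _ _)).1 this

/-- The conditional probability of `Y ≤ y` at the level `u`. -/
lemma exists_conditional (y : ℝ) : ∃ w : ℝ → ℝ, IntegrableOn w (Ioc 0 1) ∧
    ∫ u in Ioc (0 : ℝ) 1, w u = ν.real (Iic y) ∧
    (∀ᵐ u ∂(volume.restrict (Ioc (0 : ℝ) 1)), S μ ν u ≤ y → w u = 1) ∧
    ∀ᵐ u ∂(volume.restrict (Ioc (0 : ℝ) 1)), y < S μ ν u →
      w u = {v : ℝ | R μ ν v ≤ (y : EReal)}.indicator (weight μ ν) u := by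
  unfold IntegrableOn
  rw [← restrict_Ioo_eq_Ioc]
  have hreg := ae_isRegularLevel hμ hν hcx hD
  set χ : ℝ → ℝ := (Iic y).indicator fun _ => 1 with hχ
  have hχm : Measurable χ := measurable_const.indicator measurableSet_Iic
  have hχ0 : ∀ x, 0 ≤ χ x := fun x => indicator_nonneg (fun _ _ => zero_le_one) x
  have hχ1 : ∀ x, χ x ≤ 1 := fun x => indicator_le_self' (fun _ _ => zero_le_one) x
  set w : ℝ → ℝ := fun u => lowerMass μ ν u * χ (lowerPoint μ ν u) +
    (1 - lowerMass μ ν u) * χ (S μ ν u) with hw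
  have hwm : AEMeasurable w (volume.restrict (Ioo (0 : ℝ) 1)) := by
    have h1 := aemeasurable_lowerMass hμ hν hcx hD
    have h2 := hχm.comp_aemeasurable (aemeasurable_lowerPoint hμ hν hcx hD)
    have h3 := hχm.comp_aemeasurable (aemeasurable_S hμ hν hcx)
    exact (h1.mul h2).add ((aemeasurable_const.sub h1).mul h3)
  have hw0 : ∀ᵐ u ∂(volume.restrict (Ioo (0 : ℝ) 1)), 0 ≤ w u := by
    filter_upwards [hreg] with u hu
    have hp := lowerMass_mem hμ hν hcx hu
    exact add_nonneg (mul_nonneg hp.1 (hχ0 _)) (mul_nonneg (by linarith [hp.2]) (hχ0 _))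
  have hlint : ∫⁻ u in Ioo (0 : ℝ) 1, ENNReal.ofReal (w u) = ν (Iic y) := by
    rw [← law_Iic hμ hν hcx hD, ← lintegral_indicator_one measurableSet_Iic,
      lintegral_law hμ hν hcx hD (measurable_one.indicator measurableSet_Iic)]
    refine lintegral_congr_ae ?_
    filter_upwards [hreg] with u hu
    have hp := lowerMass_mem hμ hν hcx hu
    have hq : 0 ≤ 1 - lowerMass μ ν u := by linarith [hp.2]
    have he : ∀ x, ENNReal.ofReal (χ x) = (Iic y).indicator (1 : ℝ → ENNReal) x := fun x => by
      by_cases hx : x ∈ Iic y <;> simp [hχ, hx]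
    rw [hw, ENNReal.ofReal_add (mul_nonneg hp.1 (hχ0 _)) (mul_nonneg hq (hχ0 _)),
      ENNReal.ofReal_mul hp.1, ENNReal.ofReal_mul hq, he, he]
  refine ⟨w, ⟨hwm.aestronglyMeasurable, ?_⟩, ?_, ?_, ?_⟩
  · rw [hasFiniteIntegral_iff_ofReal hw0, hlint]
    exact measure_lt_top _ _
  · rw [integral_eq_lintegral_of_nonneg_ae hw0 hwm.aestronglyMeasurable, hlint, Measure.real]
  · filter_upwards [hreg] with u hu hS
    have h1 : lowerPoint μ ν u ≤ y :=
      (hu.lowerPoint_le hμ hν hcx).trans ((S_mem hμ hν hcx hu.1).1.trans hS)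
    simp only [hw, hχ]
    rw [indicator_of_mem (show lowerPoint μ ν u ∈ Iic y from h1),
      indicator_of_mem (show S μ ν u ∈ Iic y from hS)]
    ring
  · filter_upwards [hreg] with u hu hS
    simp only [hw, hχ]
    rw [indicator_of_notMem (show S μ ν u ∉ Iic y from not_le.2 hS), mul_zero, add_zero]
    -- When `S u = G u` the weight vanishes, so it is immaterial whether `R u ≤ y`; otherwise `R u`
    -- is `lowerPoint u`.
    rcases hu.cases hμ hν hcx with ⟨h, h'⟩ | ⟨h1, -⟩
    · have h0 : lowerMass μ ν u = 0 := by rw [lowerMass, h, h', sub_self, zero_div]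
      have h2 : weight μ ν u = 0 := by rw [hu.weight_eq hμ hν hcx, h0]
      rw [h0, zero_mul, indicator_apply, h2, ite_self]
    · have h2 : u ∈ {v : ℝ | R μ ν v ≤ (y : EReal)} ↔ lowerPoint μ ν u ∈ Iic y := by
        rw [mem_ofPred_eq, h1, EReal.coe_le_coe_iff, mem_Iic]
      by_cases h3 : lowerPoint μ ν u ∈ Iic y
      · rw [indicator_of_mem h3, indicator_of_mem (h2.2 h3), mul_one, hu.weight_eq hμ hν hcx]
      · rw [indicator_of_notMem h3, indicator_of_notMem (fun h => h3 (h2.1 h)), mul_zero]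

end Law

/-! ### The inverse of `S` and the final identity -/

lemma invS_mem (μ ν : Measure ℝ) (y : ℝ) : invS μ ν y ∈ Icc (0 : ℝ) 1 := by
  have hb : ∀ x ∈ insert 1 {u : ℝ | u ∈ Ioo (0 : ℝ) 1 ∧ y < S μ ν u}, 0 ≤ x := by
    rintro x (rfl | hx)
    · exact zero_le_one
    · exact hx.1.1.le
  exact ⟨le_csInf (insert_nonempty _ _) hb, csInf_le ⟨0, hb⟩ (mem_insert _ _)⟩

lemma S_le_of_lt_invS {μ ν : Measure ℝ} {u y : ℝ} (hu : u ∈ Ioo (0 : ℝ) 1) (h : u < invS μ ν y) :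
    S μ ν u ≤ y := by
  by_contra hy
  have hb : BddBelow (insert 1 {u : ℝ | u ∈ Ioo (0 : ℝ) 1 ∧ y < S μ ν u}) := by
    refine ⟨0, ?_⟩
    rintro x (rfl | hx)
    · exact zero_le_one
    · exact hx.1.1.le
  have hmem : u ∈ insert 1 {u : ℝ | u ∈ Ioo (0 : ℝ) 1 ∧ y < S μ ν u} :=
    mem_insert_of_mem _ ⟨hu, not_le.1 hy⟩
  exact absurd (csInf_le hb hmem) (not_le.2 h)

lemma lt_S_of_invS_lt {μ ν : Measure ℝ} [IsProbabilityMeasure μ] [IsProbabilityMeasure ν]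
    (hμ : Integrable (fun x : ℝ => x) μ) (hν : Integrable (fun x : ℝ => x) ν)
    (hcx : ConvexOrder μ ν) {u y : ℝ} (hu : u ∈ Ioo (0 : ℝ) 1) (h : invS μ ν y < u) :
    y < S μ ν u := by
  obtain ⟨x, hx, hxu⟩ := exists_lt_of_csInf_lt (insert_nonempty _ _) h
  rcases hx with rfl | hx
  · exact absurd hxu (not_lt.2 hu.2.le)
  · exact hx.2.trans_le (S_monotoneOn hμ hν hcx hx.1 hu hxu.le)

end LeftCurtain

open LeftCurtain

theorem proposition6p8 (μ ν : Measure ℝ) [IsProbabilityMeasure μ] [IsProbabilityMeasure ν]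
    (hμ : Integrable (fun x : ℝ => x) μ) (hν : Integrable (fun x : ℝ => x) ν)
    (hcx : LeftCurtain.ConvexOrder μ ν)
    (hD : {k : ℝ | 0 < LeftCurtain.D μ ν k}.OrdConnected)
    (y : ℝ) (hyμ : μ {y} = 0) (hyν : ν {y} = 0) :
    (DifferentiableAt ℝ (LeftCurtain.P ν) y ∧
      IntervalIntegrable
        ({v : ℝ | LeftCurtain.R μ ν v ≤ (y : EReal)}.indicator (LeftCurtain.weight μ ν))
        volume (LeftCurtain.invS μ ν y) 1 ∧
      ∫ v in (LeftCurtain.invS μ ν y)..1,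
          {v : ℝ | LeftCurtain.R μ ν v ≤ (y : EReal)}.indicator (LeftCurtain.weight μ ν) v
        = deriv (LeftCurtain.P ν) y - LeftCurtain.invS μ ν y) ∧
    (AEMeasurable (LeftCurtain.Y μ ν) LeftCurtain.unif ∧
      LeftCurtain.law μ ν (Iic y) = ν (Iic y)) := by
  refine ⟨?_, aemeasurable_Y hμ hν hcx hD, law_Iic hμ hν hcx hD y⟩
  have hderiv := hasDerivAt_P (integrable_max hν) hyν
  obtain ⟨w, hwi, hwI, hw1, hw2⟩ := exists_conditional hμ hν hcx hD y
  obtain ⟨hs0, hs1⟩ := invS_mem μ ν y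
  have hIoo : ∀ᵐ u ∂(volume.restrict (Ioc (0 : ℝ) 1)), u ∈ Ioo (0 : ℝ) 1 := by
    rw [← restrict_Ioo_eq_Ioc]
    exact ae_restrict_mem measurableSet_Ioo
  have hlow : Ioc 0 (invS μ ν y) ⊆ Ioc 0 1 := Ioc_subset_Ioc_right hs1
  have hup : Ioc (invS μ ν y) 1 ⊆ Ioc 0 1 := Ioc_subset_Ioc_left hs0
  -- At the level `invS μ ν y` itself `S` may exceed `y`; this single level is discarded as a null
  -- set.
  have hne : ∀ᵐ u : ℝ, u ≠ invS μ ν y := by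
    simp [ae_iff]
  have e1 : ∀ᵐ u ∂(volume.restrict (Ioc 0 (invS μ ν y))), w u = 1 := by
    filter_upwards [ae_restrict_of_ae_restrict_of_subset hlow hw1,
      ae_restrict_of_ae_restrict_of_subset hlow hIoo, ae_restrict_of_ae hne,
      ae_restrict_mem measurableSet_Ioc] with u h1 h2 h3 h4
    exact h1 (S_le_of_lt_invS h2 (lt_of_le_of_ne h4.2 h3))
  have e2 : ∀ᵐ u ∂(volume.restrict (Ioc (invS μ ν y) 1)),
      w u = {v : ℝ | R μ ν v ≤ (y : EReal)}.indicator (weight μ ν) u := by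
    filter_upwards [ae_restrict_of_ae_restrict_of_subset hup hw2,
      ae_restrict_of_ae_restrict_of_subset hup hIoo,
      ae_restrict_mem measurableSet_Ioc] with u h1 h2 h4
    exact h1 (lt_S_of_invS_lt hμ hν hcx h2 h4.1)
  refine ⟨hderiv.differentiableAt, ?_, ?_⟩
  · rw [intervalIntegrable_iff_integrableOn_Ioc_of_le hs1]
    exact (hwi.mono_set hup).congr e2
  · rw [hderiv.deriv, ← hwI, intervalIntegral.integral_of_le hs1, ← integral_congr_ae e2,
      ← Ioc_union_Ioc_eq_Ioc hs0 hs1, setIntegral_union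
        (Ioc_disjoint_Ioc_of_le le_rfl) measurableSet_Ioc (hwi.mono_set hlow) (hwi.mono_set hup),
      integral_congr_ae e1]
    simp [hs0]
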